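/- Let $q\in\mathbb C$ with $0<|q|<1$. Write $(a)_\infty=\prod_{j\ge0}(1-aq^j)$, $\theta(x)=(x)_\infty(q/x)_\infty$, and, for $k\in\mathbb Z$, $(a)_k=\prod_{j=0}^{k-1}(1-aq^j)$ if $k\ge 0$ and $(a)_k=\big(\prod_{j=1}^{-k}(1-aq^{-j})\big)^{-1}$ if $k<0$ (with $1/(a)_k=\prod_{j=1}^{-k}(1-aq^{-j})$ even when this product is $0$). Repeated arguments of $\theta$, $(\cdot)_k$ and $(\cdot)_\infty$ denote products, and $(ab^{\pm})_\infty=(ab)_\infty(a/b)_\infty$. Let $${}_r\psi_r\left(\begin{matrix}a_1,\dots,a_r\\ c_1,\dots,c_r\end{matrix};z\right)=\sum_{k\in\mathbb Z}\frac{(a_1,\dots,a_r)_k}{(c_1,\dots,c_r)_k}z^k,\qquad {}_8W_7(a;a_1,\dots,a_5;z)=\sum_{k=0}^\infty\frac{1-aq^{2k}}{1-a}\,\frac{(a,a_1,\dots,a_5)_k}{(q,aq/a_1,\dots,aq/a_5)_k}z^k .$$ Let $b_1,\dots,b_6\in\mathbb C$ satisfy $b_1\cdots b_6=q$. Call $\lambda\in\mathbb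 C\setminus\{0\}$ generic if $\lambda\notin \pm q^{\mathbb Z}$ and, for all $1\le j\le 6$ and all integers $m\ge1$, $\lambda q^m\ne b_j$ and $\lambda b_j\ne q^m$. For generic $\lambda$ put $$\Psi(\lambda)={}_8\psi_8\left(\begin{matrix}\lambda q,-\lambda q,\lambda b_1,\dots,\lambda b_6\\ \lambda,-\lambda,\lambda q/b_1,\dots,\lambda q/b_6\end{matrix};q\right),$$ $$f(\lambda,\mu)=\Big\{\theta(\mu b_1,\dots,\mu b_6)-\frac{q}{\mu^2}\theta(\mu/b_1,\dots,\mu/b_6)\Big\}\frac{(1-\lambda^2)\prod_{j=1}^6(q\lambda^{\pm}/b_j)_\infty}{\theta(\mu/\lambda)}\,\Psi(\lambda).$$ (i) (Bilateral Jackson summation.) If $\lambda$ and $\mu$ are generic and $\mu/\lambda\notin q^{\mathbb Z}$, then the series $\Psi(\lambda)$ and $\Psi(\mu)$ converge absolutely and $$f(\lambda,\mu)+f(\mu,\lambda)=(q)_\infty\,\theta(\lambda^2,\mu^2,\lambda\mu)\prod_{1\le i<j\le 6}(q/b_ib_j)_\infty .$$ (ii) (The case $\lambda=b_6$, $\mu=b_1$.)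 Suppose that $b_6$ and $b_1$ are generic in the above sense, that $b_1/b_6\notin q^{\mathbb Z}$, that $b_1^2q^n\neq1$ for all $n\ge1$, and that $b_1b_jq^n\ne1$ for $2\le j\le5$ and all $n\ge0$. Then $$\Psi(b_6)={}_8W_7(b_6^2;b_1b_6,\dots,b_5b_6;q),\qquad \Psi(b_1)={}_8W_7(b_1^2;b_1b_2,\dots,b_1b_6;q),$$ these ${}_8W_7$ series converge absolutely, and the nonterminating Jackson summation holds: $${}_8W_7(b_6^2;b_1 b_6,\dots,b_5 b_6;q)-\frac{b_1}{b_6}\frac{( qb_6^2,qb_1/b_6)_\infty}{(qb_1^2,qb_6/b_1)_\infty}\prod_{j=2}^5\frac{(qb_1/b_j,b_6b_j)_\infty}{(qb_6/b_j,b_1b_j)_\infty}\;{}_8W_7(b_1^2;b_1 b_2,\dots,b_1 b_6;q) =\frac{(qb_6^2,b_1/b_6)_\infty\prod_{2\leq i<j\leq 5}(q/b_ib_j)_\infty}{\prod_{j=2}^5(qb_6/b_j,b_1b_j)_\infty}.$$ -/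

import Mathlib

namespace BilateralJackson

noncomputable section

/-- The `q`-shifted factorial `(a)_k` for `k ∈ ℤ`:
`(1-a)(1-aq)⋯(1-aq^{k-1})` if `k ≥ 0` and `((1-aq^{-1})(1-aq^{-2})⋯(1-aq^{k}))⁻¹` if `k < 0`. -/
def qPoch (q a : ℂ) : ℤ → ℂ
  | Int.ofNat n => ∏ j ∈ Finset.range n, (1 - a * q ^ j)
  | Int.negSucc n => (∏ j ∈ Finset.range (n + 1), (1 - a / q ^ (j + 1)))⁻¹

/-- The infinite `q`-shifted factorial `(a)_∞ = ∏_{j ≥ 0} (1 - a q^j)`. -/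
def qPochInf (q a : ℂ) : ℂ := ∏' j : ℕ, (1 - a * q ^ j)

/-- The infinite product defining `(a)_∞` converges for `|q| < 1`. -/
theorem multipliable_qPochInf {q : ℂ} (hq : ‖q‖ < 1) (a : ℂ) :
    Multipliable (fun j : ℕ => 1 - a * q ^ j) := by
  have h : Summable (fun j : ℕ => ‖-(a * q ^ j)‖) := by
    simp only [norm_neg, norm_mul, norm_pow]
    exact (summable_geometric_of_lt_one (norm_nonneg q) hq).mul_left _
  simpa [sub_eq_add_neg] using multipliable_one_add_of_summable h

/-- The theta function `θ(x) = (x)_∞ (q/x)_∞`. -/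
def theta (q x : ℂ) : ℂ := qPochInf q x * qPochInf q (q / x)

/-- The `k`-th term of the bilateral series `ᵣψᵣ(a₁,…,aᵣ; b₁,…,bᵣ; z)`. -/
def psiTerm (q : ℂ) {r : ℕ} (a b : Fin r → ℂ) (z : ℂ) (k : ℤ) : ℂ :=
  (∏ i, qPoch q (a i) k) / (∏ i, qPoch q (b i) k) * z ^ k

/-- The bilateral basic hypergeometric series `ᵣψᵣ(a₁,…,aᵣ; b₁,…,bᵣ; z)`. -/
def psi (q : ℂ) {r : ℕ} (a b : Fin r → ℂ) (z : ℂ) : ℂ := ∑' k : ℤ, psiTerm q a b z k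

/-- The `k`-th term of the very-well-poised series `W(a; b₁,…,bₙ; z)` (this is `ₙ₊₃Wₙ₊₂`). -/
def wTerm (q a : ℂ) {n : ℕ} (b : Fin n → ℂ) (z : ℂ) (k : ℕ) : ℂ :=
  (1 - a * q ^ (2 * k)) / (1 - a) *
    ((qPoch q a k * ∏ i, qPoch q (b i) k) /
      (qPoch q q k * ∏ i, qPoch q (a * q / b i) k)) * z ^ k

/-- The very-well-poised series `W(a; b₁,…,bₙ; z)` (this is `ₙ₊₃Wₙ₊₂`). -/
def W (q a : ℂ) {n : ℕ} (b : Fin n → ℂ) (z : ℂ) : ℂ := ∑' k : ℕ, wTerm q a b z k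

/-- Numerator parameters `λq, -λq, λb₁, …, λb₆` of the `₈ψ₈` series. -/
def numParams (q : ℂ) (b : Fin 6 → ℂ) (l : ℂ) : Fin 8 → ℂ :=
  ![l * q, -l * q, l * b 0, l * b 1, l * b 2, l * b 3, l * b 4, l * b 5]

/-- Denominator parameters `λ, -λ, λq/b₁, …, λq/b₆` of the `₈ψ₈` series. -/
def denParams (q : ℂ) (b : Fin 6 → ℂ) (l : ℂ) : Fin 8 → ℂ :=
  ![l, -l, l * q / b 0, l * q / b 1, l * q / b 2, l * q / b 3, l * q / b 4, l * q / b 5]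

/-- The conditions under which no term of the `₈ψ₈` series in `λ` has a zero denominator:
`λ ≠ 0`, `λ ∉ ±q^ℤ`, and `λ/b_j ≠ q^{-m}`, `λ b_j ≠ q^m` for `m ≥ 1`. -/
structure Generic (q : ℂ) (b : Fin 6 → ℂ) (l : ℂ) : Prop where
  ne_zero : l ≠ 0
  sq_ne : ∀ k : ℤ, l ≠ q ^ k ∧ l ≠ -q ^ k
  den_ne : ∀ (j : Fin 6) (m : ℕ), 1 ≤ m → l * q ^ m ≠ b j
  num_ne : ∀ (j : Fin 6) (m : ℕ), 1 ≤ m → l * b j ≠ q ^ m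

/-- The function `f(λ, μ)` that is symmetrized on the left-hand side of the summation. -/
def jacksonSummand (q : ℂ) (b : Fin 6 → ℂ) (l m : ℂ) : ℂ :=
  ((∏ j, theta q (m * b j)) - q / m ^ 2 * ∏ j, theta q (m / b j)) *
    ((1 - l ^ 2) * (∏ j, qPochInf q (q * l / b j) * qPochInf q (q / (l * b j))) /
      theta q (m / l)) *
    psi q (numParams q b l) (denParams q b l) q

end

end BilateralJackson

open Filter Topology

namespace BilateralJackson

variable {q : ℂ}

/-! Multiply the `₈ψ₈` series by `(1 - λ²) ∏ (qλ^±/b_j)_∞`. Each term becomes holomorphic in `λ` and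
the `b_j` on the nonzero complex numbers, and so does the sum `jacksonSum`. Multiplying the left
side of (i) by `θ(μ/λ)` turns it into the bilinear expression `jacksonForm`, and the claim becomes
`jacksonForm = (q)_∞ θ(λ², μ², λμ) θ(μ/λ) · pairProd`, with no denominators.

The dependence on `b` is found by an elliptic-function argument. If `∏ a_j = 1`, the series at the
two points obtained from `a` by replacing `a_i` with `q a_i`, or `a_j` with `q a_j`, satisfy a
two-term relation with a theta-product inhomogeneity (`jacksonSum_contiguous`). It comes from
telescoping `contigSeq`, by way of a Lagrange interpolation in `x + 1/x` (`prod_sub_prod_eq`). The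
inhomogeneities at `λ` and `μ` cancel in `jacksonForm`, which therefore obeys the same homogeneous
relation as `pairProd`. Hence `jacksonForm / pairProd` is invariant under `(b_i, b_j) ↦ (q b_i, b_j
/ q)`. Near the torus `|b_k| = |q|^{1/6}` the denominator has no zeros on an annulus wider than one
period, so the maximum principle makes the quotient constant on the torus. The identity theorem, one
variable at a time, gives `jacksonForm = κ · pairProd` everywhere, with `κ` depending only on `λ`
and `μ`.

The constant is read off at `b = (μ, x, y, w, 1/λ, λ)`, where the series at `λ` has a single nonzero
term and the theta factor at `λ` vanishes.

For (ii), the specialization `λ = b₆`, `μ = b₁` has a common factor `θ(b₁b₆)`. This factor may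
vanish, so it is removed by continuity (`jacksonDefect_eq_zero`). The terms of negative index
vanish, and the bilateral series become `₈W₇` series. -/

/-! ### Infinite `q`-products and the theta function. -/

theorem qPochInf_eq_prod_mul (hq : ‖q‖ < 1) (a : ℂ) (n : ℕ) :
    qPochInf q a = (∏ j ∈ Finset.range n, (1 - a * q ^ j)) * qPochInf q (a * q ^ n) := by
  have h : Multipliable (fun j : ℕ => 1 - a * q ^ (j + n)) := by
    refine (multipliable_qPochInf hq (a * q ^ n)).congr fun j => ?_
    ring
  rw [qPochInf, ← h.prod_mul_tprod_nat_mul' (f := fun j : ℕ => 1 - a * q ^ j), qPochInf]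
  congr 1
  exact tprod_congr fun j => by ring

theorem qPochInf_eq_one_sub_mul (hq : ‖q‖ < 1) (a : ℂ) :
    qPochInf q a = (1 - a) * qPochInf q (a * q) := by
  simpa using qPochInf_eq_prod_mul hq a 1

theorem qPochInf_ne_zero (hq : ‖q‖ < 1) {a : ℂ} (h : ∀ n : ℕ, a * q ^ n ≠ 1) :
    qPochInf q a ≠ 0 := by
  have hs : Summable (fun j : ℕ => ‖-(a * q ^ j)‖) := by
    simp only [norm_neg, norm_mul, norm_pow]
    exact (summable_geometric_of_lt_one (norm_nonneg q) hq).mul_left _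
  have := tprod_one_add_ne_zero_of_summable (f := fun j : ℕ => -(a * q ^ j))
    (fun j => by simpa [← sub_eq_add_neg, sub_eq_zero] using fun e => h j e.symm) hs
  simpa [qPochInf, sub_eq_add_neg] using this

theorem qPochInf_eq_zero (hq : ‖q‖ < 1) {a : ℂ} {n : ℕ} (h : a * q ^ n = 1) :
    qPochInf q a = 0 := by
  rw [qPochInf_eq_prod_mul hq a (n + 1), Finset.prod_range_succ, h]
  simp

theorem qPochInf_one (hq : ‖q‖ < 1) : qPochInf q 1 = 0 :=
  qPochInf_eq_zero hq (n := 0) (by simp)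

theorem qPochInf_ne_zero_of_norm_lt (hq : ‖q‖ < 1) {a : ℂ} (ha : ‖a‖ < 1) :
    qPochInf q a ≠ 0 := by
  refine qPochInf_ne_zero hq fun n e => ?_
  have h := congrArg norm e
  rw [norm_mul, norm_pow, norm_one] at h
  have := mul_le_of_le_one_right (norm_nonneg a) (pow_le_one₀ (norm_nonneg q) hq.le (n := n))
  linarith

theorem norm_prod_one_sub_le (hq : ‖q‖ < 1) (a : ℂ) (n : ℕ) :
    ‖∏ j ∈ Finset.range n, (1 - a * q ^ j)‖ ≤ Real.exp (‖a‖ / (1 - ‖q‖)) := by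
  calc ‖∏ j ∈ Finset.range n, (1 - a * q ^ j)‖
      ≤ ∏ j ∈ Finset.range n, (1 + ‖a‖ * ‖q‖ ^ j) := by
        rw [norm_prod]
        refine Finset.prod_le_prod (fun _ _ => norm_nonneg _) fun j _ => ?_
        simpa using norm_sub_le (1 : ℂ) (a * q ^ j)
    _ ≤ Real.exp (∑ j ∈ Finset.range n, ‖a‖ * ‖q‖ ^ j) :=
        Real.prod_one_add_le_exp_sum _ fun j => by positivity
    _ ≤ Real.exp (‖a‖ / (1 - ‖q‖)) := by
        rw [Real.exp_le_exp, ← Finset.mul_sum, div_eq_mul_inv,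
          ← tsum_geometric_of_lt_one (norm_nonneg q) hq]
        exact mul_le_mul_of_nonneg_left ((summable_geometric_of_lt_one (norm_nonneg q)
          hq).sum_le_tsum _ fun _ _ => by positivity) (norm_nonneg a)

theorem norm_qPochInf_le (hq : ‖q‖ < 1) (a : ℂ) :
    ‖qPochInf q a‖ ≤ Real.exp (‖a‖ / (1 - ‖q‖)) :=
  le_of_tendsto ((multipliable_qPochInf hq a).tendsto_prod_tprod_nat.norm)
    (Eventually.of_forall fun n => norm_prod_one_sub_le hq a n)

theorem differentiable_qPochInf (hq : ‖q‖ < 1) : Differentiable ℂ (qPochInf q) := by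
  intro x
  have hs : Summable fun j : ℕ => (‖x‖ + 1) * ‖q‖ ^ j :=
    (summable_geometric_of_lt_one (norm_nonneg q) hq).mul_left _
  have h := (Summable.hasProdLocallyUniformlyOn_nat_one_add (R := ℂ)
    (f := fun (j : ℕ) (a : ℂ) => -(a * q ^ j)) (Metric.isOpen_ball (x := (0 : ℂ)) (ε := ‖x‖ + 1)) hs
    (Eventually.of_forall fun j a ha => by
      rw [norm_neg, norm_mul, norm_pow]
      have : ‖a‖ < ‖x‖ + 1 := by simpa using ha
      gcongr) (fun j => by fun_prop)).tendstoLocallyUniformlyOn_finsetRange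
  have hd := h.differentiableOn (Eventually.of_forall fun n => by fun_prop) Metric.isOpen_ball
  have := hd.differentiableAt (Metric.isOpen_ball.mem_nhds (x := x) (by simp))
  simpa [qPochInf, sub_eq_add_neg, Function.comp_def] using! this

theorem qPochInf_zero : qPochInf q 0 = 1 := by simp [qPochInf]

theorem continuous_qPochInf (hq : ‖q‖ < 1) : Continuous (qPochInf q) :=
  (differentiable_qPochInf hq).continuous

theorem tendsto_qPochInf_mul_pow (hq : ‖q‖ < 1) (a : ℂ) :
    Tendsto (fun n : ℕ => qPochInf q (a * q ^ n)) atTop (𝓝 1) := by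
  have h : Tendsto (fun n : ℕ => a * q ^ n) atTop (𝓝 0) := by
    simpa using (tendsto_pow_atTop_nhds_zero_of_norm_lt_one hq).const_mul a
  simpa [qPochInf_zero, Function.comp_def] using ((continuous_qPochInf hq).tendsto 0).comp h

theorem tendsto_prod_one_sub (hq : ‖q‖ < 1) (a : ℂ) :
    Tendsto (fun n : ℕ => ∏ j ∈ Finset.range n, (1 - a * q ^ j)) atTop (𝓝 (qPochInf q a)) :=
  (multipliable_qPochInf hq a).tendsto_prod_tprod_nat

/-- Shifting the argument of `(c / q^n)_∞` to the left by `n` steps. -/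
theorem qPochInf_div_pow (hq0 : q ≠ 0) (hq : ‖q‖ < 1) {a : ℂ} (ha : a ≠ 0) (n : ℕ) :
    qPochInf q (q / (a * q ^ n)) = (∏ j ∈ Finset.range n, (1 - a * q ^ j)) *
      qPochInf q (q / a) * ((-1) ^ n * (a ^ n * q ^ (n * (n - 1) / 2))⁻¹) := by
  induction n with
  | zero => simp
  | succ n ih =>
    have e : (n + 1) * (n + 1 - 1) / 2 = n * (n - 1) / 2 + n := by
      have := Nat.triangle_succ n
      simpa using this
    rw [qPochInf_eq_one_sub_mul hq]
    have e2 : q / (a * q ^ (n + 1)) * q = q / (a * q ^ n) := by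
      rw [pow_succ]; field_simp
    rw [e2, ih, e, Finset.prod_range_succ]
    have e3 : q / (a * q ^ (n + 1)) = 1 / (a * q ^ n) := by
      rw [pow_succ]; field_simp
    rw [e3]
    field_simp
    ring

theorem theta_mul (hq0 : q ≠ 0) (hq : ‖q‖ < 1) {x : ℂ} (hx : x ≠ 0) :
    theta q (q * x) = -theta q x / x := by
  rw [theta, theta, qPochInf_eq_one_sub_mul hq x,
    show q / (q * x) = 1 / x by field_simp, qPochInf_eq_one_sub_mul hq (1 / x),
    show 1 / x * q = q / x by ring, mul_comm x q]
  field_simp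
  ring

theorem theta_inv (hq : ‖q‖ < 1) {x : ℂ} (hx : x ≠ 0) :
    theta q x⁻¹ = -theta q x / x := by
  rw [theta, theta, qPochInf_eq_one_sub_mul hq x, qPochInf_eq_one_sub_mul hq x⁻¹,
    show q / x⁻¹ = x * q by simp [mul_comm], show x⁻¹ * q = q / x by ring]
  field_simp
  ring

theorem theta_div (hq0 : q ≠ 0) (hq : ‖q‖ < 1) {x : ℂ} (hx : x ≠ 0) :
    theta q (x / q) = -(x / q) * theta q x := by
  have h := theta_mul hq0 hq (x := x / q) (by positivity)
  rw [show q * (x / q) = x by field_simp] at h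
  rw [h]
  field_simp

theorem theta_one (hq : ‖q‖ < 1) : theta q 1 = 0 := by
  simp [theta, qPochInf_one hq]

theorem theta_eq_one_sub_mul (hq : ‖q‖ < 1) (x : ℂ) :
    theta q x = (1 - x) * qPochInf q (q * x) * qPochInf q (q / x) := by
  rw [theta, qPochInf_eq_one_sub_mul hq x, mul_comm x q]

theorem theta_ne_zero (hq0 : q ≠ 0) (hq : ‖q‖ < 1) {x : ℂ} (hx : x ≠ 0)
    (h : ∀ k : ℤ, x ≠ q ^ k) : theta q x ≠ 0 := by
  refine mul_ne_zero (qPochInf_ne_zero hq fun n e => ?_) (qPochInf_ne_zero hq fun n e => ?_)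
  · refine h (-n) ?_
    rw [zpow_neg, zpow_natCast]
    exact eq_inv_of_mul_eq_one_left e
  · refine h (n + 1) ?_
    rw [zpow_add₀ hq0, zpow_natCast, zpow_one]
    field_simp at e
    rw [← e]; ring

theorem differentiableOn_theta (hq : ‖q‖ < 1) : DifferentiableOn ℂ (theta q) {0}ᶜ := by
  intro x hx
  have hx : x ≠ 0 := hx
  refine DifferentiableAt.differentiableWithinAt ?_
  refine (differentiable_qPochInf hq x).mul ?_
  exact (differentiable_qPochInf hq (q / x)).comp x (by fun_prop (disch := exact hx))

/-! ### The regularized series: convergence and holomorphy. -/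

/-- The `k`-th term of the `₈ψ₈` series, multiplied by a factor that removes all its poles. -/
noncomputable def jacksonTerm (q : ℂ) (b : Fin 6 → ℂ) (l : ℂ) (k : ℤ) : ℂ :=
  l ^ (6 * k) * q ^ (3 * k ^ 2 - k) * (1 - (l * q ^ k) ^ 2) *
    ∏ j, (qPochInf q (q * (l * q ^ k) / b j) * qPochInf q (q / (l * q ^ k * b j)))

/-- The `₈ψ₈` series, multiplied by a factor that removes all its poles. -/
noncomputable def jacksonSum (q : ℂ) (b : Fin 6 → ℂ) (l : ℂ) : ℂ := ∑' k : ℤ, jacksonTerm q b l k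

theorem prod_ne_zero_apply {b : Fin 6 → ℂ} {c : ℂ} (hc : c ≠ 0) (hb : ∏ j, b j = c) (j : Fin 6) :
    b j ≠ 0 := by
  rw [← hb] at hc
  exact Finset.prod_ne_zero_iff.1 hc j (Finset.mem_univ j)

theorem prod_qPochInf_div_pow (hq0 : q ≠ 0) (hq : ‖q‖ < 1) {b : Fin 6 → ℂ} (hb : ∀ j, b j ≠ 0)
    {l : ℂ} (hl : l ≠ 0) (n : ℕ) :
    ∏ j, qPochInf q (q / (l * q ^ n * b j)) =
      (∏ j, ((∏ i ∈ Finset.range n, (1 - l * b j * q ^ i)) * qPochInf q (q / (l * b j)))) *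
        (l ^ (6 * n) * (∏ j, b j) ^ n * q ^ (3 * (n * (n - 1))))⁻¹ := by
  have e : q ^ (3 * (n * (n - 1))) = (q ^ (n * (n - 1) / 2)) ^ 6 := by
    rw [← pow_mul]
    congr 1
    have := Nat.div_mul_cancel (even_iff_two_dvd.1 (Nat.even_mul_pred_self n))
    lia
  rw [e, ← Finset.prod_pow]
  have h : ∀ j, qPochInf q (q / (l * q ^ n * b j)) =
      (∏ i ∈ Finset.range n, (1 - l * b j * q ^ i)) * qPochInf q (q / (l * b j)) *
        ((-1) ^ n * ((l * b j) ^ n * q ^ (n * (n - 1) / 2))⁻¹) := fun j => by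
    rw [mul_right_comm]
    exact qPochInf_div_pow hq0 hq (mul_ne_zero hl (hb j)) n
  simp_rw [h, Finset.prod_mul_distrib, Finset.prod_inv_distrib, Finset.prod_mul_distrib, mul_pow,
    Finset.prod_mul_distrib, Finset.prod_const, Finset.card_univ, Fintype.card_fin, ← pow_mul]
  rw [show ((-1 : ℂ)) ^ (n * 6) = 1 from Even.neg_one_pow (Even.mul_left (by decide) n)]
  ring

/-- The balancing condition `∏ b_j = q` enters here: the Gaussian powers of `q` and the powers of
`l` cancel exactly against the six reflected products. What remains is `q ^ n` times bounded
factors, hence geometric decay. -/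
theorem jacksonTerm_natCast (hq0 : q ≠ 0) (hq : ‖q‖ < 1) {b : Fin 6 → ℂ} (hb : ∏ j, b j = q)
    {l : ℂ} (hl : l ≠ 0) (n : ℕ) :
    jacksonTerm q b l n = q ^ n * (1 - (l * q ^ n) ^ 2) *
      ∏ j, (qPochInf q (q * (l * q ^ n) / b j) *
        ((∏ i ∈ Finset.range n, (1 - l * b j * q ^ i)) * qPochInf q (q / (l * b j)))) := by
  have e : l ^ (6 * (n : ℤ)) * q ^ (3 * (n : ℤ) ^ 2 - n) =
      q ^ n * (l ^ (6 * n) * q ^ n * q ^ (3 * (n * (n - 1)))) := by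
    rw [show 6 * (n : ℤ) = ((6 * n : ℕ) : ℤ) by push_cast; ring, zpow_natCast,
      show 3 * (n : ℤ) ^ 2 - n = ((n + n + 3 * (n * (n - 1)) : ℕ) : ℤ) by
        rcases n with _ | n
        · simp
        · push_cast [Nat.add_sub_cancel]; ring, zpow_natCast, pow_add, pow_add]
    ring
  rw [jacksonTerm, e, Finset.prod_mul_distrib, Finset.prod_mul_distrib, zpow_natCast,
    prod_qPochInf_div_pow hq0 hq (prod_ne_zero_apply hq0 hb) hl, hb]
  field_simp

/-- Under `(l, k) ↦ (l⁻¹, -k)` the two infinite products at each `b j` change places. Statements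
about negative indices thus reduce to nonnegative ones at `l⁻¹`. -/
theorem jacksonTerm_neg (hq0 : q ≠ 0) (b : Fin 6 → ℂ) {l : ℂ} (hl : l ≠ 0) (k : ℤ) :
    jacksonTerm q b l (-k) = -l ^ 2 * jacksonTerm q b l⁻¹ k := by
  rw [jacksonTerm, jacksonTerm]
  have hk : q ^ k ≠ 0 := zpow_ne_zero k hq0
  have h1 : ∏ j, (qPochInf q (q * (l * q ^ (-k)) / b j) * qPochInf q (q / (l * q ^ (-k) * b j))) =
      ∏ j, (qPochInf q (q * (l⁻¹ * q ^ k) / b j) * qPochInf q (q / (l⁻¹ * q ^ k * b j))) := by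
    refine Finset.prod_congr rfl fun j _ => ?_
    rw [mul_comm]
    congr 2 <;> rw [zpow_neg] <;> field_simp
  rw [h1, show 3 * (-k) ^ 2 - -k = 3 * k ^ 2 - k + k + k by ring, zpow_add₀ hq0, zpow_add₀ hq0,
    zpow_neg, show 6 * -k = -(6 * k) by ring, inv_zpow', mul_pow l⁻¹]
  field_simp
  ring

theorem norm_jacksonTerm_natCast_le (hq0 : q ≠ 0) (hq : ‖q‖ < 1) {b : Fin 6 → ℂ}
    (hb : ∏ j, b j = q) {l : ℂ} (hl0 : l ≠ 0) {M : ℝ} (hM : ∀ j, ‖b j‖ ≤ M)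
    (hM' : ∀ j, ‖(b j)⁻¹‖ ≤ M) (hl : ‖l‖ ≤ M) (hl' : ‖l⁻¹‖ ≤ M) (n : ℕ) :
    ‖jacksonTerm q b l n‖ ≤
      (1 + M ^ 2) * (Real.exp (M * M / (1 - ‖q‖)) ^ 3) ^ 6 * ‖q‖ ^ n := by
  have hM0 : 0 ≤ M := (norm_nonneg _).trans hl
  have h1 : 0 ≤ 1 - ‖q‖ := by linarith
  have hqn : ‖q ^ n‖ ≤ 1 := by
    rw [norm_pow]; exact pow_le_one₀ (norm_nonneg q) hq.le
  have hlq : ‖l * q ^ n‖ ≤ M := by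
    rw [norm_mul]; exact (mul_le_of_le_one_right (norm_nonneg l) hqn).trans hl
  have key : ∀ a : ℂ, ‖a‖ ≤ M * M →
      Real.exp (‖a‖ / (1 - ‖q‖)) ≤ Real.exp (M * M / (1 - ‖q‖)) := fun a ha =>
    Real.exp_le_exp.2 (by gcongr)
  rw [jacksonTerm_natCast hq0 hq hb hl0, norm_mul, norm_mul, norm_pow, mul_comm (‖q‖ ^ n),
    mul_right_comm]
  gcongr
  · calc ‖1 - (l * q ^ n) ^ 2‖ ≤ ‖(1 : ℂ)‖ + ‖(l * q ^ n) ^ 2‖ := norm_sub_le _ _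
      _ ≤ 1 + M ^ 2 := by rw [norm_one, norm_pow]; gcongr
  · rw [norm_prod]
    calc _ ≤ ∏ _j : Fin 6, Real.exp (M * M / (1 - ‖q‖)) ^ 3 := by
          refine Finset.prod_le_prod (fun _ _ => norm_nonneg _) fun j _ => ?_
          rw [norm_mul, norm_mul, pow_succ', pow_two]
          gcongr
          · refine (norm_qPochInf_le hq _).trans (key _ ?_)
            rw [mul_comm q, mul_div_assoc, div_eq_mul_inv, norm_mul (l * q ^ n), norm_mul q]
            calc ‖l * q ^ n‖ * (‖q‖ * ‖(b j)⁻¹‖) ≤ M * (1 * M) := by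
                  gcongr; exact hM' j
              _ = M * M := by ring
          · refine (norm_prod_one_sub_le hq _ _).trans (key _ ?_)
            rw [norm_mul]
            exact mul_le_mul hl (hM j) (norm_nonneg _) hM0
          · refine (norm_qPochInf_le hq _).trans (key _ ?_)
            rw [div_eq_mul_inv, mul_inv, norm_mul, norm_mul]
            calc ‖q‖ * (‖l⁻¹‖ * ‖(b j)⁻¹‖) ≤ 1 * (M * M) := by
                  gcongr; exact hM' j
              _ = M * M := by ring
      _ = _ := by simp

/-- The bound depends on the parameters only through `M`, so it is a Weierstrass majorant, uniform
where the parameters and their inverses stay bounded. The extra factor `1 + M ^ 2` absorbs the `-l ^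
2` of the reflection. -/
theorem norm_jacksonTerm_le (hq0 : q ≠ 0) (hq : ‖q‖ < 1) {b : Fin 6 → ℂ}
    (hb : ∏ j, b j = q) {l : ℂ} (hl0 : l ≠ 0) {M : ℝ} (hM : ∀ j, ‖b j‖ ≤ M)
    (hM' : ∀ j, ‖(b j)⁻¹‖ ≤ M) (hl : ‖l‖ ≤ M) (hl' : ‖l⁻¹‖ ≤ M) (k : ℤ) :
    ‖jacksonTerm q b l k‖ ≤ (1 + M ^ 2) *
      ((1 + M ^ 2) * (Real.exp (M * M / (1 - ‖q‖)) ^ 3) ^ 6) * ‖q‖ ^ k.natAbs := by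
  have hM0 : 0 ≤ M := (norm_nonneg _).trans hl
  set C := (1 + M ^ 2) * (Real.exp (M * M / (1 - ‖q‖)) ^ 3) ^ 6
  have hC : 0 ≤ C := by positivity
  obtain ⟨n, rfl | rfl⟩ := k.eq_nat_or_neg
  · rw [Int.natAbs_natCast]
    refine (norm_jacksonTerm_natCast_le hq0 hq hb hl0 hM hM' hl hl' n).trans ?_
    gcongr
    nlinarith [sq_nonneg M]
  · rw [Int.natAbs_neg, Int.natAbs_natCast, jacksonTerm_neg hq0 b hl0, norm_mul, norm_neg,
      norm_pow, mul_assoc (1 + M ^ 2)]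
    refine mul_le_mul ?_ (norm_jacksonTerm_natCast_le hq0 hq hb (inv_ne_zero hl0) hM hM' hl'
      (by simpa using hl) n) (norm_nonneg _) (by positivity)
    have : ‖l‖ ^ 2 ≤ M ^ 2 := by gcongr
    linarith

theorem summable_pow_natAbs (hq : ‖q‖ < 1) : Summable fun k : ℤ => ‖q‖ ^ k.natAbs := by
  have h := summable_geometric_of_lt_one (norm_nonneg q) hq
  exact Summable.of_nat_of_neg (by simpa using h) (by simpa using h)

theorem summable_jacksonTerm (hq0 : q ≠ 0) (hq : ‖q‖ < 1) {b : Fin 6 → ℂ}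
    (hb : ∏ j, b j = q) {l : ℂ} (hl0 : l ≠ 0) : Summable (jacksonTerm q b l) := by
  refine Summable.of_norm_bounded ((summable_pow_natAbs hq).mul_left _) (norm_jacksonTerm_le hq0 hq hb hl0
    (M := ‖l‖ + ‖l⁻¹‖ + ∑ j, (‖b j‖ + ‖(b j)⁻¹‖)) (fun j => ?_) (fun j => ?_) ?_ ?_)
  · have := Finset.single_le_sum (f := fun j => ‖b j‖ + ‖(b j)⁻¹‖) (fun i _ => by positivity)
      (Finset.mem_univ j)
    linarith [norm_nonneg l, norm_nonneg l⁻¹, norm_nonneg (b j)⁻¹]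
  · have := Finset.single_le_sum (f := fun j => ‖b j‖ + ‖(b j)⁻¹‖) (fun i _ => by positivity)
      (Finset.mem_univ j)
    linarith [norm_nonneg l, norm_nonneg l⁻¹, norm_nonneg (b j)]
  · have : 0 ≤ ∑ j, (‖b j‖ + ‖(b j)⁻¹‖) := by positivity
    linarith [norm_nonneg l⁻¹]
  · have : 0 ≤ ∑ j, (‖b j‖ + ‖(b j)⁻¹‖) := by positivity
    linarith [norm_nonneg l]

theorem differentiableOn_jacksonTerm (hq0 : q ≠ 0) (hq : ‖q‖ < 1) {U : Set ℂ} {l : ℂ → ℂ}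
    {b : ℂ → Fin 6 → ℂ} (hl : DifferentiableOn ℂ l U) (hb : ∀ j, DifferentiableOn ℂ (b · j) U)
    (hl0 : ∀ t ∈ U, l t ≠ 0) (hb0 : ∀ t ∈ U, ∀ j, b t j ≠ 0) (k : ℤ) :
    DifferentiableOn ℂ (fun t => jacksonTerm q (b t) (l t) k) U := by
  have hP := differentiable_qPochInf hq
  unfold jacksonTerm
  have hqk : q ^ k ≠ 0 := zpow_ne_zero k hq0
  refine DifferentiableOn.mul (DifferentiableOn.mul (DifferentiableOn.mul_const ?_ _) (by fun_prop))
    ?_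
  · exact hl.zpow (Or.inl hl0)
  · refine DifferentiableOn.fun_finsetProd fun j _ => DifferentiableOn.mul ?_ ?_
    · exact hP.comp_differentiableOn ((hl.mul_const _).const_mul q |>.fun_div (hb j)
        fun t ht => hb0 t ht j)
    · exact hP.comp_differentiableOn ((differentiableOn_const q).fun_div ((hl.mul_const _).mul (hb j))
        fun t ht => mul_ne_zero (mul_ne_zero (hl0 t ht) hqk) (hb0 t ht j))

/-- The parameters move along a holomorphic curve, so that one statement covers variation in `l` and
in pairs of the `b j`. The continuous function `G` dominates all parameters and their inverses, and
`G x + 1` serves as `M` near `x`. -/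
theorem differentiableOn_jacksonSum (hq0 : q ≠ 0) (hq : ‖q‖ < 1) {U : Set ℂ} (hU : IsOpen U)
    {l : ℂ → ℂ} {b : ℂ → Fin 6 → ℂ} (hl : DifferentiableOn ℂ l U)
    (hb : ∀ j, DifferentiableOn ℂ (b · j) U) (hl0 : ∀ t ∈ U, l t ≠ 0)
    (hbq : ∀ t ∈ U, ∏ j, b t j = q) :
    DifferentiableOn ℂ (fun t => jacksonSum q (b t) (l t)) U := by
  intro x hx
  have hb0 : ∀ t ∈ U, ∀ j, b t j ≠ 0 := fun t ht => prod_ne_zero_apply hq0 (hbq t ht)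
  set G : ℂ → ℝ := fun t => ‖l t‖ + ‖(l t)⁻¹‖ + ∑ j, (‖b t j‖ + ‖(b t j)⁻¹‖) with hG
  have hGc : ContinuousOn G U := by
    refine ContinuousOn.add (ContinuousOn.add hl.continuousOn.norm
      (hl.continuousOn.inv₀ hl0).norm) (continuousOn_finsetSum _ fun j _ => ?_)
    exact (hb j).continuousOn.norm.add
      ((hb j).continuousOn.inv₀ fun t ht => hb0 t ht j).norm
  have hev : ∀ᶠ t in 𝓝 x, t ∈ U ∧ G t < G x + 1 :=
    (hU.eventually_mem hx).and
      ((hGc.continuousAt (hU.mem_nhds hx)).eventually_lt_const (by linarith))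
  obtain ⟨V, hV, hVo, hxV⟩ := eventually_nhds_iff.1 hev
  have hVU : V ⊆ U := fun t ht => (hV t ht).1
  have := Complex.differentiableOn_tsum_of_summable_norm (U := V)
    (F := fun (k : ℤ) t => jacksonTerm q (b t) (l t) k)
    ((summable_pow_natAbs hq).mul_left ((1 + (G x + 1) ^ 2) *
      ((1 + (G x + 1) ^ 2) * (Real.exp ((G x + 1) * (G x + 1) / (1 - ‖q‖)) ^ 3) ^ 6)))
    (fun k => (differentiableOn_jacksonTerm hq0 hq hl hb hl0 hb0 k).mono hVU) hVo
    (fun k t ht => by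
      have h1 := (hV t ht).2.le
      have hs : ∀ j, ‖b t j‖ + ‖(b t j)⁻¹‖ ≤ ∑ j, (‖b t j‖ + ‖(b t j)⁻¹‖) := fun j =>
        Finset.single_le_sum (f := fun j => ‖b t j‖ + ‖(b t j)⁻¹‖) (fun i _ => by positivity)
          (Finset.mem_univ j)
      have hs0 : 0 ≤ ∑ j, (‖b t j‖ + ‖(b t j)⁻¹‖) := by positivity
      simp only [hG] at h1 ⊢
      refine norm_jacksonTerm_le hq0 hq (hbq t (hVU ht)) (hl0 t (hVU ht)) (fun j => ?_)
        (fun j => ?_) ?_ ?_ k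
      · linarith [norm_nonneg (l t), norm_nonneg (l t)⁻¹, norm_nonneg (b t j)⁻¹, hs j]
      · linarith [norm_nonneg (l t), norm_nonneg (l t)⁻¹, norm_nonneg (b t j), hs j]
      · linarith [norm_nonneg (l t)⁻¹]
      · linarith [norm_nonneg (l t)])
  exact (this.differentiableAt (hVo.mem_nhds hxV)).differentiableWithinAt

/-! ### The contiguous relation for the series. -/

theorem prod_update_eq_mul {ι : Type*} [Fintype ι] [DecidableEq ι] {α : Type*} (a : ι → α) (i : ι)
    (v : α) (g : α → ℂ) {c : ℂ} (h : g v = c * g (a i)) :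
    ∏ j, g (Function.update a i v j) = c * ∏ j, g (a j) := by
  rw [← Finset.mul_prod_erase _ _ (Finset.mem_univ i),
    ← Finset.mul_prod_erase _ (fun j => g (a j)) (Finset.mem_univ i), Function.update_self, h,
    mul_assoc]
  congr 2
  exact Finset.prod_congr rfl fun j hj => by rw [Function.update_of_ne (Finset.ne_of_mem_erase hj)]

/-- The two products are reciprocal polynomials and share their elementary symmetric functions. Once
these are named, `prod_sub_prod_eq` is a polynomial identity in a few scalars. -/
theorem exists_prod_four_eq {ι : Type*} [DecidableEq ι] (a : ι → ℂ) {s : Finset ι}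
    (hs : s.card = 4) : ∃ e₁ e₂ e₃ : ℂ, ∀ x : ℂ,
      ∏ k ∈ s, (1 - x * a k) = 1 - e₁ * x + e₂ * x ^ 2 - e₃ * x ^ 3 + (∏ k ∈ s, a k) * x ^ 4 ∧
      ∏ k ∈ s, (a k - x) = x ^ 4 - e₁ * x ^ 3 + e₂ * x ^ 2 - e₃ * x + ∏ k ∈ s, a k := by
  obtain ⟨i, t, hi, rfl, ht⟩ := Finset.card_eq_succ.1 hs
  obtain ⟨j, k, m, hjk, hjm, hkm, rfl⟩ := Finset.card_eq_three.1 ht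
  refine ⟨a i + a j + a k + a m,
    a i * a j + a i * a k + a i * a m + a j * a k + a j * a m + a k * a m,
    a i * a j * a k + a i * a j * a m + a i * a k * a m + a j * a k * a m, fun x => ?_⟩
  simp only [Finset.prod_insert hi, Finset.prod_insert (show j ∉ ({k, m} : Finset ι) by simp [*]),
    Finset.prod_insert (show k ∉ ({m} : Finset ι) by simp [*]), Finset.prod_singleton]
  constructor <;> ring

/-- Since `∏ a_k = 1`, the two products are reciprocal polynomials of degree six, and their
difference is `x² (1 - x²)` times a linear polynomial in `x + 1/x`. The right side is its Lagrange
interpolation at `x = a i` and `x = a j`: the second product vanishes at these points, and `(1 - x /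
a j) (1 - 1 / (x a j))` is linear in `x + 1/x` with a zero at `x = a j`. -/
theorem prod_sub_prod_eq {a : Fin 6 → ℂ} (ha : ∏ j, a j = 1) {i j : Fin 6} (hij : i ≠ j) {x : ℂ}
    (hx : x ≠ 0) :
    (∏ k, (1 - x * a k) - ∏ k, (1 - x / a k)) * (a i + (a i)⁻¹ - (a j + (a j)⁻¹)) =
      -(x ^ 2 * (1 - x ^ 2)) *
        (a j / a i ^ 2 * (∏ k ∈ Finset.univ.erase i, (1 - a i * a k)) *
            ((1 - x / a j) * (1 - 1 / (x * a j))) -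
          a i / a j ^ 2 * (∏ k ∈ Finset.univ.erase j, (1 - a j * a k)) *
            ((1 - x / a i) * (1 - 1 / (x * a i)))) := by
  have h0 : ∀ j, a j ≠ 0 := prod_ne_zero_apply one_ne_zero ha
  set s : Finset (Fin 6) := (Finset.univ.erase i).erase j
  have hj : j ∈ (Finset.univ.erase i : Finset (Fin 6)) := by simp [hij.symm]
  have hi : i ∈ (Finset.univ.erase j : Finset (Fin 6)) := by simp [hij]
  have hs' : (Finset.univ.erase j).erase i = s := Finset.erase_right_comm
  have hs : s.card = 4 := by
    rw [Finset.card_erase_of_mem hj, Finset.card_erase_of_mem (Finset.mem_univ i)]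
    simp
  have hall : ∀ f : Fin 6 → ℂ, ∏ k, f k = f i * (f j * ∏ k ∈ s, f k) := fun f => by
    rw [Finset.mul_prod_erase _ _ hj, Finset.mul_prod_erase _ _ (Finset.mem_univ i)]
  obtain ⟨e₁, e₂, e₃, he⟩ := exists_prod_four_eq a hs
  have hu := h0 i
  have hv := h0 j
  have he4 : ∏ k ∈ s, a k = 1 / (a i * a j) := by
    rw [hall] at ha
    field_simp
    linear_combination ha
  have h2 : ∏ k ∈ s, (1 - x / a k) = (∏ k ∈ s, (a k - x)) * (a i * a j) := by
    have : ∏ k ∈ s, (1 - x / a k) = (∏ k ∈ s, (a k - x)) / ∏ k ∈ s, a k := by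
      rw [← Finset.prod_div_distrib]
      exact Finset.prod_congr rfl fun k _ => by field_simp [h0 k]
    rw [this, he4]
    field_simp
  rw [hall (fun k => 1 - x * a k), hall (fun k => 1 - x / a k),
    ← Finset.mul_prod_erase _ (fun k => 1 - a i * a k) hj,
    ← Finset.mul_prod_erase _ (fun k => 1 - a j * a k) hi, hs', h2, (he x).1, (he x).2,
    (he (a i)).1, (he (a j)).1, he4]
  field_simp
  ring

theorem jacksonTerm_update (hq0 : q ≠ 0) (hq : ‖q‖ < 1) {a : Fin 6 → ℂ} (h0 : ∀ j, a j ≠ 0)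
    (i : Fin 6) {l : ℂ} (hl : l ≠ 0) (k : ℤ) :
    jacksonTerm q (Function.update a i (q * a i)) l k =
      (1 - l * q ^ k / a i) * (1 - 1 / (l * q ^ k * a i)) * jacksonTerm q a l k := by
  have hx : l * q ^ k ≠ 0 := mul_ne_zero hl (zpow_ne_zero k hq0)
  have hi := h0 i
  rw [jacksonTerm, jacksonTerm, prod_update_eq_mul a i (q * a i) (fun y =>
    qPochInf q (q * (l * q ^ k) / y) * qPochInf q (q / (l * q ^ k * y)))
    (c := (1 - l * q ^ k / a i) * (1 - 1 / (l * q ^ k * a i)))]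
  · ring
  · rw [show q * (l * q ^ k) / (q * a i) = l * q ^ k / a i by field_simp,
      show q / (l * q ^ k * (q * a i)) = 1 / (l * q ^ k * a i) by field_simp,
      qPochInf_eq_one_sub_mul hq (l * q ^ k / a i),
      qPochInf_eq_one_sub_mul hq (1 / (l * q ^ k * a i)),
      show l * q ^ k / a i * q = q * (l * q ^ k) / a i by ring,
      show 1 / (l * q ^ k * a i) * q = q / (l * q ^ k * a i) by ring]
    ring

/-- The sequence whose differences give the contiguous relation. -/
noncomputable def contigSeq (q : ℂ) (a : Fin 6 → ℂ) (l : ℂ) (k : ℤ) : ℂ :=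
  l ^ (6 * k) * q ^ (3 * k ^ 2 - 3 * k) *
    ∏ j, (qPochInf q (l * q ^ k / a j) * qPochInf q (q / (l * q ^ k * a j)))

/-- Relative to the common infinite products, passing to `k` restores the factors `1 - x / a j`, and
passing to `k + 1` the factors `1 - 1 / (x a j)`, where `x = l q^k`. The prefactor contributes `x ^
6`, which with `∏ a_j = 1` turns the latter into `∏ (1 - x a_j)`. -/
theorem contigSeq_succ_sub (hq0 : q ≠ 0) (hq : ‖q‖ < 1) {a : Fin 6 → ℂ} (ha : ∏ j, a j = 1)
    {l : ℂ} (hl : l ≠ 0) (k : ℤ) :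
    contigSeq q a l (k + 1) - contigSeq q a l k =
      l ^ (6 * k) * q ^ (3 * k ^ 2 - 3 * k) *
      (∏ j, (qPochInf q (q * (l * q ^ k) / a j) * qPochInf q (q / (l * q ^ k * a j)))) *
      (∏ j, (1 - l * q ^ k * a j) - ∏ j, (1 - l * q ^ k / a j)) := by
  have h0 : ∀ j, a j ≠ 0 := prod_ne_zero_apply one_ne_zero ha
  have hqk : q ^ k ≠ 0 := zpow_ne_zero k hq0
  set x := l * q ^ k with hxd
  have hx : x ≠ 0 := mul_ne_zero hl hqk
  have hx1 : l * q ^ (k + 1) = q * x := by rw [zpow_add₀ hq0, zpow_one]; ring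
  have h1 : ∏ j, (qPochInf q (x / a j) * qPochInf q (q / (x * a j))) =
      (∏ j, (1 - x / a j)) * ∏ j, (qPochInf q (q * x / a j) * qPochInf q (q / (x * a j))) := by
    rw [← Finset.prod_mul_distrib]
    refine Finset.prod_congr rfl fun j _ => ?_
    rw [qPochInf_eq_one_sub_mul hq (x / a j), show x / a j * q = q * x / a j by ring]
    ring
  have h2 : ∏ j, (qPochInf q (q * x / a j) * qPochInf q (q / (q * x * a j))) =
      (∏ j, (1 - 1 / (x * a j))) *
        ∏ j, (qPochInf q (q * x / a j) * qPochInf q (q / (x * a j))) := by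
    rw [← Finset.prod_mul_distrib]
    refine Finset.prod_congr rfl fun j _ => ?_
    rw [show q / (q * x * a j) = 1 / (x * a j) by field_simp,
      qPochInf_eq_one_sub_mul hq (1 / (x * a j)), show 1 / (x * a j) * q = q / (x * a j) by ring]
    ring
  have h3 : x ^ 6 * ∏ j, (1 - 1 / (x * a j)) = ∏ j, (1 - x * a j) := by
    have : ∀ j, (1 - 1 / (x * a j)) = (1 - x * a j) * ((-1) * (x⁻¹ * (a j)⁻¹)) := fun j => by
      have := h0 j
      field_simp
      ring
    simp_rw [this, Finset.prod_mul_distrib, Finset.prod_inv_distrib, ha]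
    simp only [Finset.prod_const, Finset.card_univ, Fintype.card_fin]
    field_simp
  have h4 : l ^ (6 * (k + 1)) * q ^ (3 * (k + 1) ^ 2 - 3 * (k + 1)) =
      l ^ (6 * k) * q ^ (3 * k ^ 2 - 3 * k) * x ^ 6 := by
    rw [show 3 * (k + 1) ^ 2 - 3 * (k + 1) = 3 * k ^ 2 - 3 * k + k * 6 by ring,
      show 6 * (k + 1) = 6 * k + 6 by ring, zpow_add₀ hq0, zpow_add₀ hl, zpow_mul q k, hxd, mul_pow]
    norm_cast
    ring
  rw [contigSeq, contigSeq, hx1, h4, h2, ← hxd, h1, ← h3]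
  ring

theorem tendsto_contigSeq (hq0 : q ≠ 0) (hq : ‖q‖ < 1) {a : Fin 6 → ℂ} (ha : ∏ j, a j = 1)
    {l : ℂ} (hl : l ≠ 0) :
    Tendsto (fun n : ℕ => contigSeq q a l n) atTop (𝓝 (∏ j, theta q (l * a j))) := by
  have h0 : ∀ j, a j ≠ 0 := prod_ne_zero_apply one_ne_zero ha
  have e : ∀ n : ℕ, contigSeq q a l n = ∏ j, (qPochInf q (l / a j * q ^ n) *
      ((∏ i ∈ Finset.range n, (1 - l * a j * q ^ i)) * qPochInf q (q / (l * a j)))) := by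
    intro n
    have h : l ^ (6 * (n : ℤ)) * q ^ (3 * (n : ℤ) ^ 2 - 3 * n) =
        l ^ (6 * n) * q ^ (3 * (n * (n - 1))) := by
      rw [show 6 * (n : ℤ) = ((6 * n : ℕ) : ℤ) by push_cast; ring, zpow_natCast,
        show 3 * (n : ℤ) ^ 2 - 3 * n = ((3 * (n * (n - 1)) : ℕ) : ℤ) by
          rcases n with _ | n
          · simp
          · push_cast [Nat.add_sub_cancel]; ring, zpow_natCast]
    rw [contigSeq, h, Finset.prod_mul_distrib, Finset.prod_mul_distrib, zpow_natCast,
      prod_qPochInf_div_pow hq0 hq h0 hl, ha]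
    simp_rw [show ∀ j, l * q ^ n / a j = l / a j * q ^ n from fun j => by ring]
    field_simp
    simp
  simp_rw [e]
  refine tendsto_finsetProd _ fun j _ => ?_
  simpa [theta] using (tendsto_qPochInf_mul_pow hq (l / a j)).mul
    ((tendsto_prod_one_sub hq (l * a j)).mul_const (qPochInf q (q / (l * a j))))

/-- The reflection that deduces the limit at `-∞` from the one at `+∞`. -/
theorem contigSeq_neg (hq0 : q ≠ 0) (a : Fin 6 → ℂ) {l : ℂ} (hl : l ≠ 0) (k : ℤ) :
    contigSeq q a l (-k) = l ^ 6 * contigSeq q a l⁻¹ (k + 1) := by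
  have hk : q ^ k ≠ 0 := zpow_ne_zero k hq0
  rw [contigSeq, contigSeq]
  have h1 : ∏ j, (qPochInf q (l * q ^ (-k) / a j) * qPochInf q (q / (l * q ^ (-k) * a j))) =
      ∏ j, (qPochInf q (l⁻¹ * q ^ (k + 1) / a j) * qPochInf q (q / (l⁻¹ * q ^ (k + 1) * a j))) := by
    refine Finset.prod_congr rfl fun j _ => ?_
    rw [mul_comm]
    congr 2 <;> rw [zpow_neg, zpow_add₀ hq0, zpow_one] <;> field_simp
  rw [h1, show 3 * (k + 1) ^ 2 - 3 * (k + 1) = 3 * (-k) ^ 2 - 3 * (-k) by ring, inv_zpow',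
    show -(6 * (k + 1)) = 6 * (-k) - 6 by ring, zpow_sub₀ hl]
  norm_cast
  field_simp

theorem prod_theta_inv (hq : ‖q‖ < 1) {a : Fin 6 → ℂ} (h0 : ∀ j, a j ≠ 0) {l : ℂ} (hl : l ≠ 0) :
    ∏ j, theta q (l⁻¹ * a j) = (∏ j, a j) / l ^ 6 * ∏ j, theta q (l / a j) := by
  have : ∀ j, theta q (l⁻¹ * a j) = (-1) * (a j * (l⁻¹ * theta q (l / a j))) := fun j => by
    rw [show l⁻¹ * a j = (l / a j)⁻¹ by rw [inv_div]; ring, theta_inv hq (div_ne_zero hl (h0 j))]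
    have := h0 j
    field_simp
  simp_rw [this, Finset.prod_mul_distrib, Finset.prod_const, Finset.card_univ, Fintype.card_fin]
  rw [show (-1 : ℂ) ^ 6 = 1 by norm_num, inv_pow]
  ring

theorem tendsto_contigSeq_neg (hq0 : q ≠ 0) (hq : ‖q‖ < 1) {a : Fin 6 → ℂ} (ha : ∏ j, a j = 1)
    {l : ℂ} (hl : l ≠ 0) :
    Tendsto (fun n : ℕ => contigSeq q a l (-n)) atTop (𝓝 (∏ j, theta q (l / a j))) := by
  have h := ((tendsto_contigSeq hq0 hq ha (inv_ne_zero hl)).comp (tendsto_add_atTop_nat 1)).const_mul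
    (l ^ 6)
  rw [prod_theta_inv hq (prod_ne_zero_apply one_ne_zero ha) hl, ha] at h
  have e : l ^ 6 * (1 / l ^ 6 * ∏ j, theta q (l / a j)) = ∏ j, theta q (l / a j) := by
    field_simp
  rw [e] at h
  refine h.congr fun n => ?_
  rw [contigSeq_neg hq0 a hl]
  simp

theorem tsum_succ_sub_eq {F : ℤ → ℂ} {A B : ℂ} (hs : Summable fun k => F (k + 1) - F k)
    (hA : Tendsto (fun n : ℕ => F n) atTop (𝓝 A))
    (hB : Tendsto (fun n : ℕ => F (-n)) atTop (𝓝 B)) : ∑' k, (F (k + 1) - F k) = A - B := by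
  have h := hs.hasSum.nat_add_neg_add_one.tendsto_sum_nat
  refine tendsto_nhds_unique h ((hA.sub hB).congr fun n => ?_)
  induction n with
  | zero => simp
  | succ n ih =>
    rw [Finset.sum_range_succ, ← ih]
    push_cast
    rw [show -((n : ℤ) + 1) + 1 = -n by ring]
    ring

/-- The difference of theta products that occurs in the contiguous relation. -/
noncomputable def thetaDiff (q : ℂ) (a : Fin 6 → ℂ) (l : ℂ) : ℂ :=
  ∏ j, theta q (l * a j) - ∏ j, theta q (l / a j)

theorem prod_update_mul {a : Fin 6 → ℂ} (ha : ∏ j, a j = 1) (i : Fin 6) :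
    ∏ j, Function.update a i (q * a i) j = q := by
  simpa [ha] using prod_update_eq_mul a i (q * a i) id (c := q) rfl

/-- By `prod_sub_prod_eq` and `jacksonTerm_update`, a combination of the two series is termwise a
difference of `contigSeq`. The sum telescopes, and the limits at the two ends form the theta
difference. -/
theorem jacksonSum_contiguous (hq0 : q ≠ 0) (hq : ‖q‖ < 1) {a : Fin 6 → ℂ} (ha : ∏ j, a j = 1)
    {i j : Fin 6} (hij : i ≠ j) (hne : a i + (a i)⁻¹ ≠ a j + (a j)⁻¹) {l : ℂ} (hl : l ≠ 0) :
    l ^ 2 * (a i / a j ^ 2 * (∏ k ∈ Finset.univ.erase j, (1 - a j * a k)) *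
        jacksonSum q (Function.update a i (q * a i)) l -
      a j / a i ^ 2 * (∏ k ∈ Finset.univ.erase i, (1 - a i * a k)) *
        jacksonSum q (Function.update a j (q * a j)) l) =
      (a i + (a i)⁻¹ - (a j + (a j)⁻¹)) * thetaDiff q a l := by
  have h0 : ∀ j, a j ≠ 0 := prod_ne_zero_apply one_ne_zero ha
  set A := a i / a j ^ 2 * (∏ k ∈ Finset.univ.erase j, (1 - a j * a k))
  set B := a j / a i ^ 2 * (∏ k ∈ Finset.univ.erase i, (1 - a i * a k))
  have hz : a i + (a i)⁻¹ - (a j + (a j)⁻¹) ≠ 0 := sub_ne_zero.2 hne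
  set z := a i + (a i)⁻¹ - (a j + (a j)⁻¹)
  have hterm : ∀ k : ℤ, contigSeq q a l (k + 1) - contigSeq q a l k =
      z⁻¹ * (l ^ 2 * (A * jacksonTerm q (Function.update a i (q * a i)) l k -
        B * jacksonTerm q (Function.update a j (q * a j)) l k)) := by
    intro k
    have hx : l * q ^ k ≠ 0 := mul_ne_zero hl (zpow_ne_zero k hq0)
    have h2 : q ^ (3 * k ^ 2 - k) = q ^ (3 * k ^ 2 - 3 * k) * (q ^ k) ^ 2 := by
      rw [show 3 * k ^ 2 - k = 3 * k ^ 2 - 3 * k + k + k by ring, zpow_add₀ hq0, zpow_add₀ hq0]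
      ring
    rw [contigSeq_succ_sub hq0 hq ha hl, eq_inv_mul_iff_mul_eq₀ hz, mul_comm z, mul_assoc,
      prod_sub_prod_eq ha hij hx, jacksonTerm_update hq0 hq h0 i hl,
      jacksonTerm_update hq0 hq h0 j hl, jacksonTerm, h2]
    ring
  have hsi := summable_jacksonTerm hq0 hq (prod_update_mul (q := q) ha i) hl
  have hsj := summable_jacksonTerm hq0 hq (prod_update_mul (q := q) ha j) hl
  have hs := (((hsi.mul_left A).sub (hsj.mul_left B)).mul_left (l ^ 2)).mul_left z⁻¹
  have ht := tsum_succ_sub_eq (F := contigSeq q a l) (by simpa only [hterm] using hs)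
    (tendsto_contigSeq hq0 hq ha hl) (tendsto_contigSeq_neg hq0 hq ha hl)
  simp_rw [hterm] at ht
  rw [tsum_mul_left, tsum_mul_left, (hsi.mul_left A).tsum_sub (hsj.mul_left B), tsum_mul_left,
    tsum_mul_left, inv_mul_eq_iff_eq_mul₀ hz] at ht
  exact ht

/-! ### The bilinear form and the pair product under parameter shifts. -/

/-- The theta factor of `jacksonSummand`. -/
noncomputable def thetaFactor (q : ℂ) (b : Fin 6 → ℂ) (m : ℂ) : ℂ :=
  ∏ j, theta q (m * b j) - q / m ^ 2 * ∏ j, theta q (m / b j)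

/-- The left-hand side of the bilateral Jackson summation, without denominators. -/
noncomputable def jacksonForm (q l m : ℂ) (b : Fin 6 → ℂ) : ℂ :=
  jacksonSum q b l * thetaFactor q b m - m / l * (jacksonSum q b m * thetaFactor q b l)

/-- The product of all `(q / b_i b_j)_∞` with `i < j`. -/
noncomputable def pairProd (q : ℂ) (b : Fin 6 → ℂ) : ℂ :=
  ∏ i, ∏ j ∈ Finset.Ioi i, qPochInf q (q / (b i * b j))

/-- Quasi-periodicity of `θ` gives both products the same factor `-1 / (m a i)`, the second one
thanks to its coefficient `q / m ^ 2`. The theta factor is thus the inhomogeneity of the contiguous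
relation. -/
theorem thetaFactor_update (hq0 : q ≠ 0) (hq : ‖q‖ < 1) {a : Fin 6 → ℂ} (h0 : ∀ j, a j ≠ 0)
    (i : Fin 6) {m : ℂ} (hm : m ≠ 0) :
    thetaFactor q (Function.update a i (q * a i)) m = -(thetaDiff q a m / (m * a i)) := by
  have hi := h0 i
  have h1 : theta q (m * (q * a i)) = -(1 / (m * a i)) * theta q (m * a i) := by
    rw [show m * (q * a i) = q * (m * a i) by ring, theta_mul hq0 hq (mul_ne_zero hm hi)]
    ring
  have h2 : theta q (m / (q * a i)) = -(m / (q * a i)) * theta q (m / a i) := by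
    rw [show m / (q * a i) = m / a i / q by field_simp, theta_div hq0 hq (div_ne_zero hm hi)]
  rw [thetaFactor, thetaDiff, prod_update_eq_mul a i (q * a i) (fun y => theta q (m * y)) h1,
    prod_update_eq_mul a i (q * a i) (fun y => theta q (m / y)) h2]
  field_simp
  ring

/-- The inhomogeneities at `l` and at `m` are proportional to `thetaDiff` at `l` and at `m`. Each is
weighted by the other theta difference, so they cancel in the antisymmetric combination. -/
theorem jacksonForm_contiguous (hq0 : q ≠ 0) (hq : ‖q‖ < 1) {a : Fin 6 → ℂ} (ha : ∏ j, a j = 1)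
    {i j : Fin 6} (hij : i ≠ j) (hne : a i + (a i)⁻¹ ≠ a j + (a j)⁻¹) {l m : ℂ} (hl : l ≠ 0)
    (hm : m ≠ 0) :
    (a i ^ 2 / a j ^ 2 * (∏ k ∈ Finset.univ.erase j, (1 - a j * a k))) *
        jacksonForm q l m (Function.update a i (q * a i)) =
      (a j ^ 2 / a i ^ 2 * (∏ k ∈ Finset.univ.erase i, (1 - a i * a k))) *
        jacksonForm q l m (Function.update a j (q * a j)) := by
  have h0 : ∀ j, a j ≠ 0 := prod_ne_zero_apply one_ne_zero ha
  have hi := h0 i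
  have hj := h0 j
  have hL := jacksonSum_contiguous hq0 hq ha hij hne hl
  have hM := jacksonSum_contiguous hq0 hq ha hij hne hm
  simp only [jacksonForm, thetaFactor_update hq0 hq h0 _ hl, thetaFactor_update hq0 hq h0 _ hm]
  set A := ∏ k ∈ Finset.univ.erase j, (1 - a j * a k)
  set B := ∏ k ∈ Finset.univ.erase i, (1 - a i * a k)
  rw [mul_comm, ← eq_div_iff (pow_ne_zero 2 hl)] at hL
  rw [mul_comm, ← eq_div_iff (pow_ne_zero 2 hm)] at hM
  set S₁ := jacksonSum q (Function.update a i (q * a i)) l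
  set S₂ := jacksonSum q (Function.update a j (q * a j)) l
  set S₃ := jacksonSum q (Function.update a i (q * a i)) m
  set S₄ := jacksonSum q (Function.update a j (q * a j)) m
  -- Here `u` and `v` stand for `thetaDiff` at `m` and at `l`.
  have key : ∀ u v : ℂ, a i ^ 2 / a j ^ 2 * A * (S₁ * -(u / (m * a i)) - m / l * (S₃ * -(v / (l * a i)))) -
      a j ^ 2 / a i ^ 2 * B * (S₂ * -(u / (m * a j)) - m / l * (S₄ * -(v / (l * a j)))) =
      -(u / m) * (a i / a j ^ 2 * A * S₁ - a j / a i ^ 2 * B * S₂) +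
      m * v / l ^ 2 * (a i / a j ^ 2 * A * S₃ - a j / a i ^ 2 * B * S₄) := fun u v => by
    field_simp
    ring
  rw [← sub_eq_zero, key, hL, hM]
  field_simp
  ring

theorem pairProd_update (hq0 : q ≠ 0) (hq : ‖q‖ < 1) (a : Fin 6 → ℂ)
    (i : Fin 6) :
    pairProd q (Function.update a i (q * a i)) =
      (∏ k ∈ Finset.univ.erase i, (1 - 1 / (a i * a k))) * pairProd q a := by
  have h : ∀ k, qPochInf q (q / (q * a i * a k)) =
      (1 - 1 / (a i * a k)) * qPochInf q (q / (a i * a k)) := fun k => by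
    rw [show q / (q * a i * a k) = 1 / (a i * a k) by field_simp, qPochInf_eq_one_sub_mul hq,
      show 1 / (a i * a k) * q = q / (a i * a k) by ring]
  have h' : ∀ k, qPochInf q (q / (a k * (q * a i))) =
      (1 - 1 / (a i * a k)) * qPochInf q (q / (a k * a i)) := fun k => by
    rw [mul_comm (a k), h k, mul_comm (a k)]
  have e0 : (Finset.Ioi 0 : Finset (Fin 6)) = {1, 2, 3, 4, 5} := by decide
  have e1 : (Finset.Ioi 1 : Finset (Fin 6)) = {2, 3, 4, 5} := by decide
  have e2 : (Finset.Ioi 2 : Finset (Fin 6)) = {3, 4, 5} := by decide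
  have e3 : (Finset.Ioi 3 : Finset (Fin 6)) = {4, 5} := by decide
  have e4 : (Finset.Ioi 4 : Finset (Fin 6)) = {5} := by decide
  have e5 : (Finset.Ioi 5 : Finset (Fin 6)) = ∅ := by decide
  have f0 : (Finset.univ.erase 0 : Finset (Fin 6)) = {1, 2, 3, 4, 5} := by decide
  have f1 : (Finset.univ.erase 1 : Finset (Fin 6)) = {0, 2, 3, 4, 5} := by decide
  have f2 : (Finset.univ.erase 2 : Finset (Fin 6)) = {0, 1, 3, 4, 5} := by decide
  have f3 : (Finset.univ.erase 3 : Finset (Fin 6)) = {0, 1, 2, 4, 5} := by decide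
  have f4 : (Finset.univ.erase 4 : Finset (Fin 6)) = {0, 1, 2, 3, 5} := by decide
  have f5 : (Finset.univ.erase 5 : Finset (Fin 6)) = {0, 1, 2, 3, 4} := by decide
  simp only [pairProd, Fin.prod_univ_six, e0, e1, e2, e3, e4, e5, Finset.prod_empty]
  fin_cases i <;> simp [f0, f1, f2, f3, f4, f5, Finset.prod_insert, Function.update] at h h' ⊢ <;>
    simp only [h, h'] <;> ring

/-- Since `∏_{k ≠ i} a_k = 1 / a_i`, inverting the arguments of the five factors costs only `-1 /
a_i ^ 4`. The coefficients therefore agree with those in `jacksonForm_contiguous`. -/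
theorem pairProd_contiguous (hq0 : q ≠ 0) (hq : ‖q‖ < 1) {a : Fin 6 → ℂ} (ha : ∏ j, a j = 1)
    (i j : Fin 6) :
    (a i ^ 2 / a j ^ 2 * (∏ k ∈ Finset.univ.erase j, (1 - a j * a k))) *
        pairProd q (Function.update a i (q * a i)) =
      (a j ^ 2 / a i ^ 2 * (∏ k ∈ Finset.univ.erase i, (1 - a i * a k))) *
        pairProd q (Function.update a j (q * a j)) := by
  have h0 : ∀ j, a j ≠ 0 := prod_ne_zero_apply one_ne_zero ha
  have h : ∀ i, ∏ k ∈ Finset.univ.erase i, (1 - 1 / (a i * a k)) =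
      -(∏ k ∈ Finset.univ.erase i, (1 - a i * a k)) / a i ^ 4 := fun i => by
    have hi := h0 i
    have e : ∀ k, 1 - 1 / (a i * a k) = (1 - a i * a k) * ((-1) * ((a i)⁻¹ * (a k)⁻¹)) := fun k => by
      have := h0 k
      field_simp
      ring
    have e2 : ∏ k ∈ Finset.univ.erase i, a k = (a i)⁻¹ := by
      rw [← Finset.mul_prod_erase _ _ (Finset.mem_univ i)] at ha
      exact eq_inv_of_mul_eq_one_right ha
    simp_rw [e, Finset.prod_mul_distrib, Finset.prod_inv_distrib, e2, Finset.prod_const,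
      Finset.card_erase_of_mem (Finset.mem_univ i), Finset.card_univ, Fintype.card_fin]
    norm_num
    field_simp
  rw [pairProd_update hq0 hq, pairProd_update hq0 hq, h, h]
  have hi := h0 i
  have hj := h0 j
  field_simp

theorem jacksonForm_mul_pairProd_update (hq0 : q ≠ 0) (hq : ‖q‖ < 1) {a : Fin 6 → ℂ}
    (ha : ∏ j, a j = 1) {i j : Fin 6} (hij : i ≠ j) (hne : a i + (a i)⁻¹ ≠ a j + (a j)⁻¹)
    (hi1 : ∀ k ≠ i, a i * a k ≠ 1) (hj1 : ∀ k ≠ j, a j * a k ≠ 1)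
    {l m : ℂ} (hl : l ≠ 0) (hm : m ≠ 0) :
    jacksonForm q l m (Function.update a i (q * a i)) *
        pairProd q (Function.update a j (q * a j)) =
      jacksonForm q l m (Function.update a j (q * a j)) *
        pairProd q (Function.update a i (q * a i)) := by
  have h0 : ∀ j, a j ≠ 0 := prod_ne_zero_apply one_ne_zero ha
  have hE := jacksonForm_contiguous hq0 hq ha hij hne hl hm
  have hP := pairProd_contiguous hq0 hq ha i j
  have hA : a i ^ 2 / a j ^ 2 * (∏ k ∈ Finset.univ.erase j, (1 - a j * a k)) ≠ 0 :=
    mul_ne_zero (div_ne_zero (pow_ne_zero 2 (h0 i)) (pow_ne_zero 2 (h0 j)))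
      (Finset.prod_ne_zero_iff.2 fun k hk => sub_ne_zero.2 (hj1 k (Finset.ne_of_mem_erase hk)).symm)
  have hB : a j ^ 2 / a i ^ 2 * (∏ k ∈ Finset.univ.erase i, (1 - a i * a k)) ≠ 0 :=
    mul_ne_zero (div_ne_zero (pow_ne_zero 2 (h0 j)) (pow_ne_zero 2 (h0 i)))
      (Finset.prod_ne_zero_iff.2 fun k hk => sub_ne_zero.2 (hi1 k (Finset.ne_of_mem_erase hk)).symm)
  refine mul_left_cancel₀ (mul_ne_zero hA hB) ?_
  linear_combination (a j ^ 2 / a i ^ 2 * (∏ k ∈ Finset.univ.erase i, (1 - a i * a k)) *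
    pairProd q (Function.update a j (q * a j))) * hE -
    (a j ^ 2 / a i ^ 2 * (∏ k ∈ Finset.univ.erase i, (1 - a i * a k)) *
    jacksonForm q l m (Function.update a j (q * a j))) * hP

/-! ### Rigidity of holomorphic functions on annuli and tori. -/

theorem isPreconnected_annulus {r R : ℝ} (hr : 0 < r) :
    IsPreconnected {t : ℂ | r < ‖t‖ ∧ ‖t‖ < R} := by
  rcases le_or_gt R 0 with hR | hR
  · have : {t : ℂ | r < ‖t‖ ∧ ‖t‖ < R} = ∅ := by
      ext t
      simp only [Set.mem_ofPred_eq, Set.mem_empty_iff_false, iff_false, not_and, not_lt]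
      intro
      exact hR.trans (norm_nonneg t)
    rw [this]
    exact isPreconnected_empty
  have : {t : ℂ | r < ‖t‖ ∧ ‖t‖ < R} =
      Complex.exp '' (Complex.re ⁻¹' Set.Ioo (Real.log r) (Real.log R)) := by
    ext t
    constructor
    · rintro ⟨h1, h2⟩
      have ht : t ≠ 0 := norm_pos_iff.1 (hr.trans h1)
      refine ⟨Complex.log t, ?_, Complex.exp_log ht⟩
      rw [Set.mem_preimage, Complex.log_re]
      exact ⟨Real.log_lt_log hr h1, Real.log_lt_log (hr.trans h1) h2⟩
    · rintro ⟨z, ⟨h1, h2⟩, rfl⟩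
      rw [Set.mem_ofPred_eq, Complex.norm_exp]
      exact ⟨(Real.log_lt_iff_lt_exp hr).1 h1, (Real.lt_log_iff_exp_lt hR).1 h2⟩
  rw [this]
  exact ((convex_Ioo _ _).linear_preimage Complex.reLm).isPreconnected.image _
    Complex.continuous_exp.continuousOn

/-- A holomorphic function on an annulus all of whose values are taken on a smaller closed annulus
is constant. -/
theorem eq_of_differentiableOn_annulus {f : ℂ → ℂ} {r c C R : ℝ} (hr : 0 < r) (hrc : r < c)
    (hCR : C < R) (hf : DifferentiableOn ℂ f {t : ℂ | r < ‖t‖ ∧ ‖t‖ < R})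
    (h : ∀ t : ℂ, r < ‖t‖ → ‖t‖ < R → ∃ t' : ℂ, c ≤ ‖t'‖ ∧ ‖t'‖ ≤ C ∧ f t' = f t)
    {t t' : ℂ} (ht : r < ‖t‖ ∧ ‖t‖ < R) (ht' : r < ‖t'‖ ∧ ‖t'‖ < R) : f t = f t' := by
  set U := {t : ℂ | r < ‖t‖ ∧ ‖t‖ < R} with hU
  set K := {t : ℂ | c ≤ ‖t‖ ∧ ‖t‖ ≤ C} with hK
  have hUo : IsOpen U :=
    (isOpen_lt continuous_const continuous_norm).inter (isOpen_lt continuous_norm continuous_const)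
  have hKU : K ⊆ U := fun x hx => ⟨hrc.trans_le hx.1, hx.2.trans_lt hCR⟩
  have hKc : IsCompact K := by
    refine (isCompact_closedBall (0 : ℂ) C).of_isClosed_subset ?_ fun x hx => by simpa using hx.2
    exact (isClosed_le continuous_const continuous_norm).inter
      (isClosed_le continuous_norm continuous_const)
  obtain ⟨t₀, h1, h2, -⟩ := h t ht.1 ht.2
  obtain ⟨x, hxK, hx⟩ := hKc.exists_isMaxOn ⟨t₀, h1, h2⟩ (hf.continuousOn.mono hKU).norm
  -- Every value on `U` is already taken on `K`, so the maximum over the compact `K` is an interior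
  -- maximum over `U`.
  have hmax : IsMaxOn (norm ∘ f) U x := fun y hy => by
    obtain ⟨y', h1, h2, h3⟩ := h y hy.1 hy.2
    rw [Set.mem_ofPred_eq, Function.comp_apply, ← h3]
    exact hx ⟨h1, h2⟩
  have := Complex.eqOn_of_isPreconnected_of_isMaxOn_norm (isPreconnected_annulus hr) hUo hf
    (hKU hxK) hmax
  exact (this ht).trans (this ht').symm

theorem eq_zero_of_eq_zero_on_sphere {g : ℂ → ℂ} (hg : DifferentiableOn ℂ g {0}ᶜ) {ρ : ℝ}
    (hρ : 0 < ρ) (h : ∀ t : ℂ, ‖t‖ = ρ → g t = 0) {t : ℂ} (ht : t ≠ 0) : g t = 0 := by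
  have hrank : 1 < Module.rank ℝ ℂ := by
    rw [Complex.rank_real_complex]
    norm_num
  have hinf : (Metric.sphere (0 : ℂ) ρ).Infinite := by
    refine (isPreconnected_sphere hrank 0 ρ).infinite_of_nontrivial ⟨ρ, ?_, -ρ, ?_, ?_⟩
    · simp [abs_of_pos hρ]
    · simp [abs_of_pos hρ]
    · intro e
      have e' : (ρ : ℂ) = 0 := by linear_combination e / 2
      exact hρ.ne' (by exact_mod_cast e')
  obtain ⟨z, hz, hacc⟩ := hinf.exists_accPt_of_subset_isCompact (isCompact_sphere _ _) subset_rfl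
  have hz0 : z ∈ ({0}ᶜ : Set ℂ) := by
    rw [mem_sphere_zero_iff_norm] at hz
    exact norm_pos_iff.1 (hz ▸ hρ)
  have hfreq : ∃ᶠ w in 𝓝[≠] z, g w = 0 :=
    (accPt_iff_frequently_nhdsNE.1 hacc).mono fun w hw => h w (mem_sphere_zero_iff_norm.1 hw)
  exact (hg.analyticOnNhd isOpen_compl_singleton).eqOn_zero_of_preconnected_of_frequently_eq_zero
    (isConnected_compl_singleton_of_one_lt_rank hrank 0).isPreconnected hz0 hfreq ht

theorem eq_of_update_eq {ι : Type*} [Fintype ι] [DecidableEq ι] {f : (ι → ℂ) → ℂ} {ρ : ℝ}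
    (h : ∀ c : ι → ℂ, (∀ k, ‖c k‖ = ρ) → ∀ (k : ι) (t : ℂ), ‖t‖ = ρ →
      f (Function.update c k t) = f c)
    {c c' : ι → ℂ} (hc : ∀ k, ‖c k‖ = ρ) (hc' : ∀ k, ‖c' k‖ = ρ) : f c = f c' := by
  suffices H : ∀ (s : Finset ι) (c : ι → ℂ), (∀ k, ‖c k‖ = ρ) → (∀ k ∉ s, c k = c' k) → f c = f c' by
    exact H Finset.univ c hc fun k hk => absurd (Finset.mem_univ k) hk
  intro s
  induction s using Finset.induction_on with
  | empty => exact fun c _ h' => congrArg f (funext fun k => h' k (by simp))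
  | insert k s hk ih =>
    intro c hc h'
    rw [← h c hc k (c' k) (hc' k)]
    refine ih _ (fun j => ?_) fun j hj => ?_
    · rcases eq_or_ne j k with rfl | hjk
      · simp [hc']
      · simp [hjk, hc]
    · rcases eq_or_ne j k with rfl | hjk
      · simp
      · simpa [hjk] using h' j (by simp [hjk, hj])

/-- Coordinates are freed from the circle one at a time, so the one-variable identity theorem
suffices. -/
theorem eq_zero_of_eq_zero_on_torus {ι : Type*} [Fintype ι] [DecidableEq ι] {H : (ι → ℂ) → ℂ}
    {ρ : ℝ} (hρ : 0 < ρ)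
    (hd : ∀ c : ι → ℂ, (∀ k, c k ≠ 0) → ∀ k : ι,
      DifferentiableOn ℂ (fun t => H (Function.update c k t)) {0}ᶜ)
    (h : ∀ c : ι → ℂ, (∀ k, ‖c k‖ = ρ) → H c = 0) {c : ι → ℂ} (hc : ∀ k, c k ≠ 0) : H c = 0 := by
  suffices G : ∀ (s : Finset ι) (c : ι → ℂ), (∀ k, c k ≠ 0) → (∀ k ∉ s, ‖c k‖ = ρ) → H c = 0 by
    exact G Finset.univ c hc fun k hk => absurd (Finset.mem_univ k) hk
  intro s
  induction s using Finset.induction_on with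
  | empty => exact fun c _ h' => h c fun k => h' k (by simp)
  | insert k s hk ih =>
    intro c hc h'
    have := eq_zero_of_eq_zero_on_sphere (hd c hc k) hρ (fun t ht => ?_) (hc k)
    · simpa using this
    · refine ih _ (fun j => ?_) fun j hj => ?_
      · rcases eq_or_ne j k with rfl | hjk
        · simpa using norm_pos_iff.1 (ht ▸ hρ)
        · simp [hjk, hc]
      · rcases eq_or_ne j k with rfl | hjk
        · simpa using ht
        · simpa [hjk] using h' j (by simp [hjk, hj])

/-! ### Constancy of the quotient on the torus. -/

theorem DifferentiableOn.theta (hq : ‖q‖ < 1) {U : Set ℂ} {f : ℂ → ℂ}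
    (hf : DifferentiableOn ℂ f U) (h0 : ∀ t ∈ U, f t ≠ 0) :
    DifferentiableOn ℂ (fun t => theta q (f t)) U :=
  (differentiableOn_theta hq).comp hf fun t ht => h0 t ht

theorem differentiableOn_thetaFactor (hq : ‖q‖ < 1) {U : Set ℂ} {m : ℂ → ℂ} {b : ℂ → Fin 6 → ℂ}
    (hm : DifferentiableOn ℂ m U) (hb : ∀ j, DifferentiableOn ℂ (b · j) U)
    (hm0 : ∀ t ∈ U, m t ≠ 0) (hb0 : ∀ t ∈ U, ∀ j, b t j ≠ 0) :
    DifferentiableOn ℂ (fun t => thetaFactor q (b t) (m t)) U := by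
  refine DifferentiableOn.sub ?_ (DifferentiableOn.mul ?_ ?_)
  · exact DifferentiableOn.fun_finsetProd fun j _ => DifferentiableOn.theta hq (hm.fun_mul (hb j))
      fun t ht => mul_ne_zero (hm0 t ht) (hb0 t ht j)
  · exact (differentiableOn_const q).fun_div (hm.fun_pow 2) fun t ht => pow_ne_zero 2 (hm0 t ht)
  · exact DifferentiableOn.fun_finsetProd fun j _ => DifferentiableOn.theta hq
      (hm.fun_div (hb j) fun t ht => hb0 t ht j) fun t ht => div_ne_zero (hm0 t ht) (hb0 t ht j)

theorem differentiableOn_jacksonForm (hq0 : q ≠ 0) (hq : ‖q‖ < 1) {U : Set ℂ} (hU : IsOpen U)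
    {l m : ℂ → ℂ} {b : ℂ → Fin 6 → ℂ} (hl : DifferentiableOn ℂ l U) (hm : DifferentiableOn ℂ m U)
    (hb : ∀ j, DifferentiableOn ℂ (b · j) U) (hl0 : ∀ t ∈ U, l t ≠ 0) (hm0 : ∀ t ∈ U, m t ≠ 0)
    (hbq : ∀ t ∈ U, ∏ j, b t j = q) :
    DifferentiableOn ℂ (fun t => jacksonForm q (l t) (m t) (b t)) U := by
  have hb0 : ∀ t ∈ U, ∀ j, b t j ≠ 0 := fun t ht => prod_ne_zero_apply hq0 (hbq t ht)
  exact ((differentiableOn_jacksonSum hq0 hq hU hl hb hl0 hbq).mul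
    (differentiableOn_thetaFactor hq hm hb hm0 hb0)).sub ((hm.fun_div hl hl0).mul
    ((differentiableOn_jacksonSum hq0 hq hU hm hb hm0 hbq).mul
    (differentiableOn_thetaFactor hq hl hb hl0 hb0)))

theorem differentiableOn_pairProd (hq : ‖q‖ < 1) {U : Set ℂ} {b : ℂ → Fin 6 → ℂ}
    (hb : ∀ j, DifferentiableOn ℂ (b · j) U) (hb0 : ∀ t ∈ U, ∀ j, b t j ≠ 0) :
    DifferentiableOn ℂ (fun t => pairProd q (b t)) U :=
  DifferentiableOn.fun_finsetProd fun i _ => DifferentiableOn.fun_finsetProd fun j _ =>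
    (differentiable_qPochInf hq).comp_differentiableOn ((differentiableOn_const q).fun_div
      ((hb i).fun_mul (hb j)) fun t ht => mul_ne_zero (hb0 t ht i) (hb0 t ht j))

/-- Multiply one parameter by `t` and divide another one by `t`. -/
noncomputable def shiftPair (b : Fin 6 → ℂ) (i j : Fin 6) (t : ℂ) : Fin 6 → ℂ :=
  Function.update (Function.update b i (b i * t)) j (b j / t)

theorem shiftPair_left (b : Fin 6 → ℂ) {i j : Fin 6} (hij : i ≠ j) (t : ℂ) :
    shiftPair b i j t i = b i * t := by
  simp [shiftPair, hij]

theorem shiftPair_right (b : Fin 6 → ℂ) (i j : Fin 6) (t : ℂ) : shiftPair b i j t j = b j / t := by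
  simp [shiftPair]

theorem shiftPair_of_ne (b : Fin 6 → ℂ) {i j k : Fin 6} (hi : k ≠ i) (hj : k ≠ j) (t : ℂ) :
    shiftPair b i j t k = b k := by
  simp [shiftPair, hi, hj]

theorem prod_update_update (b : Fin 6 → ℂ) {i j : Fin 6} (hij : i ≠ j) {u v c : ℂ}
    (h : u * v = c * (b i * b j)) :
    ∏ k, Function.update (Function.update b i u) j v k = c * ∏ k, b k := by
  have hi : i ∈ (Finset.univ.erase j : Finset (Fin 6)) := by simp [hij]
  rw [← Finset.mul_prod_erase _ b (Finset.mem_univ j), ← Finset.mul_prod_erase _ b hi,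
    ← Finset.mul_prod_erase _ _ (Finset.mem_univ j), ← Finset.mul_prod_erase _ _ hi,
    Function.update_self, Function.update_of_ne hij, Function.update_self,
    Finset.prod_congr rfl (g := b) fun k hk => ?_]
  · linear_combination (∏ x ∈ (Finset.univ.erase j).erase i, b x) * h
  · simp only [Finset.mem_erase] at hk
    rw [Function.update_of_ne hk.2.1, Function.update_of_ne hk.1]

theorem prod_shiftPair (b : Fin 6 → ℂ) {i j : Fin 6} (hij : i ≠ j) {t : ℂ} (ht : t ≠ 0) :
    ∏ k, shiftPair b i j t k = ∏ k, b k := by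
  rw [shiftPair, prod_update_update b hij (c := 1) (by field_simp), one_mul]

theorem differentiableOn_shiftPair (b : Fin 6 → ℂ) (i j : Fin 6) {U : Set ℂ}
    (hU : ∀ t ∈ U, t ≠ 0) (k : Fin 6) :
    DifferentiableOn ℂ (fun t => shiftPair b i j t k) U := by
  unfold shiftPair
  rcases eq_or_ne k j with rfl | hj
  · simp only [Function.update_self]
    exact (differentiableOn_const _).fun_div differentiableOn_id hU
  · simp only [Function.update_of_ne hj]
    rcases eq_or_ne k i with rfl | hi
    · simp only [Function.update_self]
      fun_prop
    · simp only [Function.update_of_ne hi]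
      fun_prop

theorem log_norm_mul {x y : ℂ} (hx : x ≠ 0) (hy : y ≠ 0) :
    Real.log ‖x * y‖ = Real.log ‖x‖ + Real.log ‖y‖ := by
  rw [norm_mul, Real.log_mul (norm_ne_zero_iff.2 hx) (norm_ne_zero_iff.2 hy)]

theorem log_norm_div {x y : ℂ} (hx : x ≠ 0) (hy : y ≠ 0) :
    Real.log ‖x / y‖ = Real.log ‖x‖ - Real.log ‖y‖ := by
  rw [norm_div, Real.log_div (norm_ne_zero_iff.2 hx) (norm_ne_zero_iff.2 hy)]

theorem pairProd_ne_zero (hq0 : q ≠ 0) (hq : ‖q‖ < 1) {b : Fin 6 → ℂ} (h0 : ∀ k, b k ≠ 0)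
    (h : ∀ k l, k ≠ l → Real.log ‖q‖ < Real.log ‖b k‖ + Real.log ‖b l‖) : pairProd q b ≠ 0 := by
  refine Finset.prod_ne_zero_iff.2 fun k _ => Finset.prod_ne_zero_iff.2 fun l hl =>
    qPochInf_ne_zero_of_norm_lt hq ?_
  have h1 := mul_ne_zero (h0 k) (h0 l)
  rw [← Real.log_neg_iff (norm_pos_iff.2 (div_ne_zero hq0 h1)), log_norm_div hq0 h1,
    log_norm_mul (h0 k) (h0 l)]
  linarith [h k l (Finset.mem_Ioi.1 hl).ne]

/-- The parameters at `t` and at `q * t` both arise from one point `a` with product `1`, by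
multiplying `a j`, respectively `a i`, by `q`. The excluded coincidences are ruled out by moduli:
with `|t| = |q|^{-s}`, `a i * a k = 1` for a third index `k` needs `s = 1/3` and `a i = a j` needs
`s = 1/2`. The window `7/20 < s < 9/20` lies strictly between. -/
theorem jacksonForm_shiftPair_mul (hq0 : q ≠ 0) (hq : ‖q‖ < 1) {b : Fin 6 → ℂ} (hb : ∏ j, b j = q)
    (hbt : ∀ k, Real.log ‖b k‖ = Real.log ‖q‖ / 6) {i j : Fin 6} (hij : i ≠ j) {l m : ℂ}
    (hl : l ≠ 0) (hm : m ≠ 0) {t : ℂ} (ht : t ≠ 0) (h1 : -(7 / 20) * Real.log ‖q‖ < Real.log ‖t‖)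
    (h2 : Real.log ‖t‖ < -(9 / 20) * Real.log ‖q‖) :
    jacksonForm q l m (shiftPair b i j (q * t)) * pairProd q (shiftPair b i j t) =
      jacksonForm q l m (shiftPair b i j t) * pairProd q (shiftPair b i j (q * t)) := by
  have hL : Real.log ‖q‖ < 0 := Real.log_neg (norm_pos_iff.2 hq0) hq
  have hb0 := prod_ne_zero_apply hq0 hb
  have hqt : q * t ≠ 0 := mul_ne_zero hq0 ht
  set a := Function.update (Function.update b i (b i * t)) j (b j / (q * t)) with ha
  have hai : a i = b i * t := by simp [ha, hij]
  have haj : a j = b j / (q * t) := by simp [ha]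
  have hak : ∀ k, k ≠ i → k ≠ j → a k = b k := fun k hi hj => by simp [ha, hi, hj]
  have hprod : ∏ k, a k = 1 := by
    rw [ha, prod_update_update b hij (c := 1 / q) (by field_simp), hb]
    field_simp
  have e1 : Function.update a j (q * a j) = shiftPair b i j t := by
    rw [haj, ha, Function.update_idem, shiftPair]
    congr 1
    field_simp
  have e2 : Function.update a i (q * a i) = shiftPair b i j (q * t) := by
    rw [hai, ha, Function.update_comm hij, Function.update_idem, Function.update_comm hij.symm,
      shiftPair]
    congr 2
    ring
  have a0 := prod_ne_zero_apply one_ne_zero hprod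
  have li : Real.log ‖a i‖ = Real.log ‖q‖ / 6 + Real.log ‖t‖ := by
    rw [hai, log_norm_mul (hb0 i) ht, hbt]
  have lj : Real.log ‖a j‖ = Real.log ‖q‖ / 6 - Real.log ‖q‖ - Real.log ‖t‖ := by
    rw [haj, log_norm_div (hb0 j) hqt, log_norm_mul hq0 ht, hbt]
    ring
  have lk : ∀ k, k ≠ i → k ≠ j → Real.log ‖a k‖ = Real.log ‖q‖ / 6 := fun k hi hj => by
    rw [hak k hi hj, hbt]
  have hone : ∀ {x y : Fin 6}, a x * a y = 1 → Real.log ‖a x‖ + Real.log ‖a y‖ = 0 :=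
    fun {x y} e => by
      rw [← log_norm_mul (a0 x) (a0 y), e]
      simp
  have key := jacksonForm_mul_pairProd_update hq0 hq hprod hij (l := l) (m := m) ?_ ?_ ?_ hl hm
  · rwa [e1, e2] at key
  · intro e
    have hx := a0 i
    have hy := a0 j
    have e' : (a i - a j) * (a i * a j - 1) = 0 := by
      field_simp at e
      linear_combination e
    rcases mul_eq_zero.1 e' with e' | e'
    · have := congrArg (fun z : ℂ => Real.log ‖z‖) (sub_eq_zero.1 e')
      simp only [li, lj] at this
      linarith
    · have := hone (sub_eq_zero.1 e')
      linarith
  · intro k hk e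
    have := hone e
    rcases eq_or_ne k j with rfl | hkj
    · linarith
    · rw [lk k hk hkj] at this
      linarith
  · intro k hk e
    have := hone e
    rcases eq_or_ne k i with rfl | hki
    · linarith
    · rw [lk k hki hk] at this
      linarith

/-- The smallest modulus of a product of two parameters is at least `|q|^{1/3 + 13/20}`, and `1/3 +
13/20 < 1`. All arguments of the factors therefore lie in the unit disc. -/
theorem pairProd_shiftPair_ne_zero (hq0 : q ≠ 0) (hq : ‖q‖ < 1) {b : Fin 6 → ℂ}
    (hb : ∏ j, b j = q) (hbt : ∀ k, Real.log ‖b k‖ = Real.log ‖q‖ / 6) {i j : Fin 6} (hij : i ≠ j)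
    {t : ℂ} (ht : t ≠ 0) (h1 : 13 / 20 * Real.log ‖q‖ < Real.log ‖t‖)
    (h2 : Real.log ‖t‖ < -(13 / 20) * Real.log ‖q‖) : pairProd q (shiftPair b i j t) ≠ 0 := by
  have hL : Real.log ‖q‖ < 0 := Real.log_neg (norm_pos_iff.2 hq0) hq
  have hb0 := prod_ne_zero_apply hq0 hb
  have s0 := prod_ne_zero_apply hq0 ((prod_shiftPair b hij ht).trans hb)
  have li : Real.log ‖shiftPair b i j t i‖ = Real.log ‖q‖ / 6 + Real.log ‖t‖ := by
    rw [shiftPair_left b hij, log_norm_mul (hb0 i) ht, hbt]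
  have lj : Real.log ‖shiftPair b i j t j‖ = Real.log ‖q‖ / 6 - Real.log ‖t‖ := by
    rw [shiftPair_right, log_norm_div (hb0 j) ht, hbt]
  have lk : ∀ k, k ≠ i → k ≠ j → Real.log ‖shiftPair b i j t k‖ = Real.log ‖q‖ / 6 :=
    fun k hi hj => by rw [shiftPair_of_ne b hi hj, hbt]
  refine pairProd_ne_zero hq0 hq s0 fun x y hxy => ?_
  rcases eq_or_ne x i with rfl | hxi <;> rcases eq_or_ne y j with rfl | hyj
  · linarith
  · rw [lk y hxy.symm hyj]; linarith
  · rcases eq_or_ne y x with rfl | h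
    · exact absurd rfl hxy
    · rw [lk x hxi hxy]; linarith
  · rcases eq_or_ne x j with rfl | hxj <;> rcases eq_or_ne y i with rfl | hyi
    · linarith
    · rw [lk y hyi hyj]; linarith
    · rw [lk x hxy hxj]; linarith
    · rw [lk x hxi hxj, lk y hyi hyj]; linarith

theorem jacksonForm_div_pairProd_shiftPair (hq0 : q ≠ 0) (hq : ‖q‖ < 1) {b : Fin 6 → ℂ}
    (hb : ∏ j, b j = q) (hbt : ∀ k, Real.log ‖b k‖ = Real.log ‖q‖ / 6) {i j : Fin 6} (hij : i ≠ j)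
    {l m : ℂ} (hl : l ≠ 0) (hm : m ≠ 0) {t : ℂ} (ht : ‖t‖ = 1) :
    jacksonForm q l m (shiftPair b i j t) / pairProd q (shiftPair b i j t) =
      jacksonForm q l m b / pairProd q b := by
  have hL : Real.log ‖q‖ < 0 := Real.log_neg (norm_pos_iff.2 hq0) hq
  -- The open annulus spans `22/20` of a period. Its part with `|t|` above `|q|^{-7/20}` is carried
  -- by `t ↦ q * t` into its inner collar, and only there is invariance needed.
  have hmem : ∀ {t : ℂ}, (Real.exp (13 / 20 * Real.log ‖q‖) < ‖t‖ ∧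
      ‖t‖ < Real.exp (-(9 / 20) * Real.log ‖q‖)) ↔ t ≠ 0 ∧ 13 / 20 * Real.log ‖q‖ < Real.log ‖t‖ ∧
        Real.log ‖t‖ < -(9 / 20) * Real.log ‖q‖ := fun {t} => by
    constructor
    · rintro ⟨h1, h2⟩
      have h0 : 0 < ‖t‖ := (Real.exp_pos _).trans h1
      exact ⟨norm_pos_iff.1 h0, (Real.lt_log_iff_exp_lt h0).2 h1, (Real.log_lt_iff_lt_exp h0).2 h2⟩
    · rintro ⟨h0, h1, h2⟩
      have h0 := norm_pos_iff.2 h0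
      exact ⟨(Real.lt_log_iff_exp_lt h0).1 h1, (Real.log_lt_iff_lt_exp h0).1 h2⟩
  have hne : ∀ {t : ℂ}, t ≠ 0 → 13 / 20 * Real.log ‖q‖ < Real.log ‖t‖ →
      Real.log ‖t‖ < -(9 / 20) * Real.log ‖q‖ → pairProd q (shiftPair b i j t) ≠ 0 :=
    fun h0 h1 h2 => pairProd_shiftPair_ne_zero hq0 hq hb hbt hij h0 h1 (by linarith)
  have hsp : ∀ {t : ℂ}, t ≠ 0 → ∏ k, shiftPair b i j t k = q := fun h0 =>
    (prod_shiftPair b hij h0).trans hb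
  set U := {t : ℂ | Real.exp (13 / 20 * Real.log ‖q‖) < ‖t‖ ∧
      ‖t‖ < Real.exp (-(9 / 20) * Real.log ‖q‖)} with hU
  have hUo : IsOpen U :=
    (isOpen_lt continuous_const continuous_norm).inter (isOpen_lt continuous_norm continuous_const)
  have hU0 : ∀ t ∈ U, t ≠ 0 := fun t ht => (hmem.1 ht).1
  have hshift : ∀ {t : ℂ}, t ≠ 0 → -(7 / 20) * Real.log ‖q‖ < Real.log ‖t‖ →
      Real.log ‖t‖ < -(9 / 20) * Real.log ‖q‖ →
      jacksonForm q l m (shiftPair b i j (q * t)) / pairProd q (shiftPair b i j (q * t)) =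
        jacksonForm q l m (shiftPair b i j t) / pairProd q (shiftPair b i j t) :=
    fun {t} h0 h1 h2 => by
      have hlog := log_norm_mul hq0 h0
      rw [div_eq_div_iff (hne (mul_ne_zero hq0 h0) (by linarith) (by linarith))
        (hne h0 (by linarith) h2)]
      exact jacksonForm_shiftPair_mul hq0 hq hb hbt hij hl hm h0 h1 h2
  have hd : DifferentiableOn ℂ (fun t => jacksonForm q l m (shiftPair b i j t) /
      pairProd q (shiftPair b i j t)) U := by
    refine DifferentiableOn.fun_div ?_ ?_ fun t ht => ?_
    · exact differentiableOn_jacksonForm hq0 hq hUo (differentiableOn_const l)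
        (differentiableOn_const m) (differentiableOn_shiftPair b i j hU0) (fun _ _ => hl)
        (fun _ _ => hm) fun t ht => hsp (hU0 t ht)
    · exact differentiableOn_pairProd hq (differentiableOn_shiftPair b i j hU0)
        fun t ht => prod_ne_zero_apply hq0 (hsp (hU0 t ht))
    · obtain ⟨h0, h1, h2⟩ := hmem.1 ht
      exact hne h0 h1 h2
  -- The closed annulus from `|q|^{12/20}` to `|q|^{-8/20}` spans exactly one period, so every point
  -- of the open annulus moves into it by at most one step of `q` or `q⁻¹`.
  have key := eq_of_differentiableOn_annulus (c := Real.exp (12 / 20 * Real.log ‖q‖))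
    (C := Real.exp (-(8 / 20) * Real.log ‖q‖)) (Real.exp_pos _)
    (Real.exp_lt_exp.2 (by linarith)) (Real.exp_lt_exp.2 (by linarith)) hd ?_
    (t := t) (t' := 1) (hmem.2 ⟨norm_ne_zero_iff.1 (by simp [ht]), by rw [ht, Real.log_one]; linarith,
      by rw [ht, Real.log_one]; linarith⟩)
    (hmem.2 ⟨one_ne_zero, by rw [norm_one, Real.log_one]; linarith,
      by rw [norm_one, Real.log_one]; linarith⟩)
  · have e : shiftPair b i j 1 = b := by simp [shiftPair]
    simpa [e] using key
  · intro t h1 h2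
    obtain ⟨h0, h1, h2⟩ := hmem.1 ⟨h1, h2⟩
    have hK : ∀ {t : ℂ}, t ≠ 0 → 12 / 20 * Real.log ‖q‖ ≤ Real.log ‖t‖ →
        Real.log ‖t‖ ≤ -(8 / 20) * Real.log ‖q‖ → Real.exp (12 / 20 * Real.log ‖q‖) ≤ ‖t‖ ∧
          ‖t‖ ≤ Real.exp (-(8 / 20) * Real.log ‖q‖) := fun h0 h1 h2 =>
      ⟨(Real.le_log_iff_exp_le (norm_pos_iff.2 h0)).1 h1,
        (Real.log_le_iff_le_exp (norm_pos_iff.2 h0)).1 h2⟩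
    rcases lt_or_ge (Real.log ‖t‖) (12 / 20 * Real.log ‖q‖) with h3 | h3
    · have hlog := log_norm_div h0 hq0
      have h0' := div_ne_zero h0 hq0
      have := hK h0' (by linarith) (by linarith)
      refine ⟨t / q, this.1, this.2, ?_⟩
      have := hshift h0' (by linarith) (by linarith)
      rw [mul_div_cancel₀ _ hq0] at this
      exact this.symm
    rcases lt_or_ge (-(8 / 20) * Real.log ‖q‖) (Real.log ‖t‖) with h4 | h4
    · have hlog := log_norm_mul hq0 h0
      have := hK (mul_ne_zero hq0 h0) (by linarith) (by linarith)
      exact ⟨q * t, this.1, this.2, hshift h0 (by linarith) h2⟩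
    · have := hK h0 h3 h4
      exact ⟨t, this.1, this.2, rfl⟩

/-! ### Proportionality for all parameters with product `q`. -/

/-- Six parameters with product `q`, the first five of which are prescribed. -/
noncomputable def extendParams (q : ℂ) (c : Fin 5 → ℂ) : Fin 6 → ℂ :=
  Fin.snoc (α := fun _ => ℂ) c (q / ∏ k, c k)

theorem extendParams_castSucc (c : Fin 5 → ℂ) (k : Fin 5) :
    extendParams q c k.castSucc = c k := by
  simp [extendParams]

theorem extendParams_last (c : Fin 5 → ℂ) :
    extendParams q c (Fin.last 5) = q / ∏ k, c k :=
  Fin.snoc_last (α := fun _ => ℂ) _ _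

theorem prod_extendParams {c : Fin 5 → ℂ} (hc : ∀ k, c k ≠ 0) : ∏ k, extendParams q c k = q := by
  have h : ∏ k, c k ≠ 0 := Finset.prod_ne_zero_iff.2 fun k _ => hc k
  rw [Fin.prod_univ_castSucc, extendParams_last]
  simp_rw [extendParams_castSucc]
  field_simp

theorem prod_update_eq_mul_div {c : Fin 5 → ℂ} {k : Fin 5} (hc : c k ≠ 0) (t : ℂ) :
    ∏ i, Function.update c k t i = t / c k * ∏ i, c i :=
  prod_update_eq_mul c k t id (by simp [hc])

/-- Changing one free coordinate changes the last parameter inversely, which is a `shiftPair`. On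
the torus the ratio `t / c k` has modulus one. -/
theorem extendParams_update {c : Fin 5 → ℂ} (hc : ∀ k, c k ≠ 0) (k : Fin 5) {t : ℂ} (ht : t ≠ 0) :
    extendParams q (Function.update c k t) =
      shiftPair (extendParams q c) k.castSucc (Fin.last 5) (t / c k) := by
  have h : ∏ k, c k ≠ 0 := Finset.prod_ne_zero_iff.2 fun k _ => hc k
  have hk := hc k
  ext i
  refine Fin.lastCases ?_ (fun i => ?_) i
  · rw [shiftPair_right, extendParams_last, extendParams_last, prod_update_eq_mul_div hk]
    field_simp
  · rw [extendParams_castSucc]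
    rcases eq_or_ne i k with rfl | hik
    · rw [shiftPair_left _ (Fin.castSucc_lt_last _).ne, extendParams_castSucc, Function.update_self]
      field_simp
    · rw [shiftPair_of_ne _ (by simpa using hik) (Fin.castSucc_lt_last _).ne,
        extendParams_castSucc, Function.update_of_ne hik]

theorem differentiableOn_extendParams_update {c : Fin 5 → ℂ} (hc : ∀ k, c k ≠ 0) (k : Fin 5)
    (i : Fin 6) :
    DifferentiableOn ℂ (fun t => extendParams q (Function.update c k t) i) {0}ᶜ := by
  have h : ∏ k, c k ≠ 0 := Finset.prod_ne_zero_iff.2 fun k _ => hc k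
  refine Fin.lastCases ?_ (fun i => ?_) i
  · simp_rw [extendParams_last, prod_update_eq_mul_div (hc k)]
    refine (differentiableOn_const q).fun_div (by fun_prop) fun t ht => ?_
    exact mul_ne_zero (div_ne_zero ht (hc k)) h
  · simp_rw [extendParams_castSucc]
    rcases eq_or_ne i k with rfl | hik
    · simp only [Function.update_self]
      fun_prop
    · simp only [Function.update_of_ne hik]
      fun_prop

theorem log_norm_extendParams (hq0 : q ≠ 0) {c : Fin 5 → ℂ}
    (hc : ∀ k, ‖c k‖ = Real.exp (Real.log ‖q‖ / 6)) (k : Fin 6) :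
    Real.log ‖extendParams q c k‖ = Real.log ‖q‖ / 6 := by
  refine Fin.lastCases ?_ (fun k => ?_) k
  · have h0 : ∀ k, c k ≠ 0 := fun k => norm_pos_iff.1 (hc k ▸ Real.exp_pos _)
    have h : ∏ k, c k ≠ 0 := Finset.prod_ne_zero_iff.2 fun k _ => h0 k
    rw [extendParams_last, log_norm_div hq0 h, norm_prod]
    simp_rw [hc]
    rw [Finset.prod_const, Real.log_pow, Real.log_exp]
    simp
    ring
  · rw [extendParams_castSucc, hc, Real.log_exp]

theorem exists_jacksonForm_eq_mul_pairProd (hq0 : q ≠ 0) (hq : ‖q‖ < 1) {l m : ℂ} (hl : l ≠ 0)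
    (hm : m ≠ 0) :
    ∃ κ : ℂ, ∀ b : Fin 6 → ℂ, ∏ j, b j = q → jacksonForm q l m b = κ * pairProd q b := by
  have hL : Real.log ‖q‖ < 0 := Real.log_neg (norm_pos_iff.2 hq0) hq
  set ρ := Real.exp (Real.log ‖q‖ / 6) with hρd
  have hρ : 0 < ρ := Real.exp_pos _
  have h0 : ∀ {c : Fin 5 → ℂ}, (∀ k, ‖c k‖ = ρ) → ∀ k, c k ≠ 0 := fun hc k =>
    norm_pos_iff.1 (hc k ▸ hρ)
  set f : (Fin 5 → ℂ) → ℂ := fun c =>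
    jacksonForm q l m (extendParams q c) / pairProd q (extendParams q c) with hf
  have hP : ∀ c : Fin 5 → ℂ, (∀ k, ‖c k‖ = ρ) → pairProd q (extendParams q c) ≠ 0 := fun c hc =>
    pairProd_ne_zero hq0 hq (prod_ne_zero_apply hq0 (prod_extendParams (h0 hc))) fun k l _ => by
      rw [log_norm_extendParams hq0 hc, log_norm_extendParams hq0 hc]
      linarith
  have hupd : ∀ c : Fin 5 → ℂ, (∀ k, ‖c k‖ = ρ) → ∀ (k : Fin 5) (t : ℂ), ‖t‖ = ρ →
      f (Function.update c k t) = f c := fun c hc k t ht => by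
    have ht0 : t ≠ 0 := norm_pos_iff.1 (ht ▸ hρ)
    simp only [hf, extendParams_update (h0 hc) k ht0]
    exact jacksonForm_div_pairProd_shiftPair hq0 hq (prod_extendParams (h0 hc))
      (log_norm_extendParams hq0 hc) (Fin.castSucc_lt_last _).ne hl hm
      (by rw [norm_div, ht, hc, div_self hρ.ne'])
  refine ⟨f fun _ => ρ, fun b hb => ?_⟩
  have hb0 := prod_ne_zero_apply hq0 hb
  have key := eq_zero_of_eq_zero_on_torus (ι := Fin 5) (H := fun c =>
    jacksonForm q l m (extendParams q c) - f (fun _ => ρ) * pairProd q (extendParams q c))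
    hρ (fun c hc k => ?_) (fun c hc => ?_) (c := fun k => b k.castSucc) (fun k => hb0 _)
  · have e : extendParams q (fun k => b k.castSucc) = b := by
      ext i
      refine Fin.lastCases ?_ (fun i => ?_) i
      · rw [extendParams_last, div_eq_iff (Finset.prod_ne_zero_iff.2 fun k _ => hb0 _), ← hb,
          Fin.prod_univ_castSucc, mul_comm]
      · rw [extendParams_castSucc]
    simp only [e] at key
    exact sub_eq_zero.1 key
  · have hprod : ∀ t ∈ ({0}ᶜ : Set ℂ), ∏ i, extendParams q (Function.update c k t) i = q :=
      fun t ht => prod_extendParams fun i => by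
        rcases eq_or_ne i k with rfl | hik
        · simpa using ht
        · simpa [hik] using hc i
    refine DifferentiableOn.sub ?_ (DifferentiableOn.mul (differentiableOn_const _) ?_)
    · exact differentiableOn_jacksonForm hq0 hq isOpen_compl_singleton (differentiableOn_const l)
        (differentiableOn_const m) (differentiableOn_extendParams_update hc k) (fun _ _ => hl)
        (fun _ _ => hm) hprod
    · exact differentiableOn_pairProd hq (differentiableOn_extendParams_update hc k)
        fun t ht => prod_ne_zero_apply hq0 (hprod t ht)
  · have e : f c = f fun _ => (ρ : ℂ) := eq_of_update_eq hupd hc fun _ => by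
      simp [abs_of_pos hρ]
    rw [← e, hf, div_mul_cancel₀ _ (hP c hc), sub_self]

/-! ### Evaluation of the constant. -/

theorem exists_forall_mul_ne_zpow (q : ℂ) (s : Finset ℂ) :
    ∃ y : ℂ, y ≠ 0 ∧ ∀ c ∈ s, c ≠ 0 → ∀ k : ℤ, c * y ≠ q ^ k := by
  have h : ({0} ∪ ⋃ c ∈ s, ⋃ k : ℤ, {q ^ k / c} : Set ℂ).Countable :=
    (Set.countable_singleton 0).union <| s.countable_toSet.biUnion fun c _ =>
      Set.countable_iUnion fun k => Set.countable_singleton _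
  obtain ⟨y, hy⟩ := (h.dense_compl ℝ).nonempty
  simp only [Set.mem_compl_iff, Set.mem_union, Set.mem_singleton_iff, Set.mem_iUnion, not_or,
    not_exists] at hy
  refine ⟨y, hy.1, fun c hc hc0 k e => hy.2 c hc k ?_⟩
  rw [← e]
  field_simp

theorem eq_zero_of_eq_zero_off_countable {f : ℂ → ℂ} {x : ℂ} (hf : ContinuousAt f x) {C : Set ℂ}
    (hC : C.Countable) (h : ∀ t ∉ C, f t = 0) : f x = 0 := by
  by_contra hx
  obtain ⟨V, hV, hVo, hxV⟩ := eventually_nhds_iff.1 (hf.eventually_ne hx)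
  obtain ⟨t, htV, htC⟩ := (hC.dense_compl ℝ).inter_open_nonempty V hVo ⟨x, hxV⟩
  exact hV t htV (h t htC)

/-- The parameter `l` kills the terms with `k < 0` and the parameter `l⁻¹` those with `k > 0`. -/
theorem jacksonSum_of_apply_eq_inv (hq0 : q ≠ 0) (hq : ‖q‖ < 1) {b : Fin 6 → ℂ} {l : ℂ} (hl : l ≠ 0)
    {i j : Fin 6} (hi : b i = l⁻¹) (hj : b j = l) :
    jacksonSum q b l = (1 - l ^ 2) * ∏ j, (qPochInf q (q * l / b j) * qPochInf q (q / (l * b j))) := by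
  rw [jacksonSum, tsum_eq_single 0]
  · simp [jacksonTerm]
  · intro k hk
    rw [jacksonTerm, mul_eq_zero]
    right
    have hqk : q ^ k ≠ 0 := zpow_ne_zero k hq0
    rcases lt_or_gt_of_ne hk with hk | hk
    · refine Finset.prod_eq_zero (Finset.mem_univ j) ?_
      obtain ⟨n, hn⟩ := Int.eq_ofNat_of_zero_le (show 0 ≤ -k - 1 by lia)
      rw [qPochInf_eq_zero hq (n := n), zero_mul]
      rw [hj, ← zpow_natCast, ← hn, zpow_sub₀ hq0, zpow_neg, zpow_one]
      field_simp
    · refine Finset.prod_eq_zero (Finset.mem_univ i) ?_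
      obtain ⟨n, hn⟩ := Int.eq_ofNat_of_zero_le (show 0 ≤ k - 1 by lia)
      rw [mul_comm, qPochInf_eq_zero hq (n := n), zero_mul]
      rw [hi, ← zpow_natCast, ← hn, zpow_sub₀ hq0, zpow_one]
      field_simp

theorem pairProd_eq (b : Fin 6 → ℂ) :
    pairProd q b =
      (qPochInf q (q / (b 0 * b 1)) * (qPochInf q (q / (b 0 * b 2)) *
        (qPochInf q (q / (b 0 * b 3)) * (qPochInf q (q / (b 0 * b 4)) *
          qPochInf q (q / (b 0 * b 5)))))) *
      (qPochInf q (q / (b 1 * b 2)) * (qPochInf q (q / (b 1 * b 3)) *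
        (qPochInf q (q / (b 1 * b 4)) * qPochInf q (q / (b 1 * b 5))))) *
      (qPochInf q (q / (b 2 * b 3)) * (qPochInf q (q / (b 2 * b 4)) *
        qPochInf q (q / (b 2 * b 5)))) *
      (qPochInf q (q / (b 3 * b 4)) * qPochInf q (q / (b 3 * b 5))) *
      qPochInf q (q / (b 4 * b 5)) := by
  have e0 : (Finset.Ioi 0 : Finset (Fin 6)) = {1, 2, 3, 4, 5} := by decide
  have e1 : (Finset.Ioi 1 : Finset (Fin 6)) = {2, 3, 4, 5} := by decide
  have e2 : (Finset.Ioi 2 : Finset (Fin 6)) = {3, 4, 5} := by decide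
  have e3 : (Finset.Ioi 3 : Finset (Fin 6)) = {4, 5} := by decide
  have e4 : (Finset.Ioi 4 : Finset (Fin 6)) = {5} := by decide
  have e5 : (Finset.Ioi 5 : Finset (Fin 6)) = ∅ := by decide
  simp only [pairProd, Fin.prod_univ_six, e0, e1, e2, e3, e4, e5, Finset.prod_empty]
  simp [Finset.prod_insert]

/-- The parameters `l⁻¹` and `l` put `θ(1)` into both products of the theta factor at `l`, and the
parameter `m` does so in the second product at `m`. Only one product survives, and `m * x * y * w =
q` identifies its factors with those of the right side. -/
theorem jacksonForm_special (hq0 : q ≠ 0) (hq : ‖q‖ < 1) {l m x y w : ℂ} (hl : l ≠ 0)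
    (hx : x ≠ 0) (hy : y ≠ 0) (hw : m * x * y * w = q) :
    jacksonForm q l m ![m, x, y, w, l⁻¹, l] =
      qPochInf q q * (theta q (l ^ 2) * theta q (m ^ 2) * theta q (l * m)) * theta q (m / l) *
        pairProd q ![m, x, y, w, l⁻¹, l] := by
  have h0 : m * x * y * w ≠ 0 := hw ▸ hq0
  have hm : m ≠ 0 := by rintro rfl; simp at h0
  have hw0 : w ≠ 0 := by rintro rfl; simp at h0
  have hN : thetaFactor q ![m, x, y, w, l⁻¹, l] l = 0 := by
    simp [thetaFactor, Fin.prod_univ_six, hl, theta_one hq]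
  rw [jacksonForm, hN, jacksonSum_of_apply_eq_inv hq0 hq hl (i := 4) (j := 5) rfl rfl, pairProd_eq]
  have e1 : q / (x * y) = m * w := by rw [← hw]; field_simp
  have e2 : q / (x * w) = m * y := by rw [← hw]; field_simp
  have e3 : q / (y * w) = m * x := by rw [← hw]; field_simp
  simp only [thetaFactor, Fin.prod_univ_six, Matrix.cons_val]
  rw [div_self hm, theta_one hq, theta_eq_one_sub_mul hq (l ^ 2), e1, e2, e3,
    inv_mul_cancel₀ hl, mul_inv_cancel₀ hl, mul_div_assoc q l l, div_self hl, mul_one, div_one]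
  simp only [div_inv_eq_mul, ← div_eq_mul_inv]
  rw [show q * l * l = q * l ^ 2 by ring, show l * l = l ^ 2 by ring, show m * m = m ^ 2 by ring]
  simp only [theta, show ∀ z, q / (z / l) = q * l / z from fun z => by field_simp]
  rw [mul_comm l m, mul_comm l x, mul_comm l y, mul_comm l w]
  ring

theorem qPochInf_div_ne_zero (hq0 : q ≠ 0) (hq : ‖q‖ < 1) {z : ℂ} (hz : z ≠ 0)
    (h : ∀ k : ℤ, z ≠ q ^ k) : qPochInf q (q / z) ≠ 0 := fun e =>
  theta_ne_zero hq0 hq hz h (by rw [theta, e, mul_zero])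

theorem jacksonForm_eq_of_generic (hq0 : q ≠ 0) (hq : ‖q‖ < 1) {l m : ℂ} (hl : l ≠ 0) (hm : m ≠ 0)
    (h1 : ∀ k : ℤ, m / l ≠ q ^ k) (h2 : ∀ k : ℤ, m * l ≠ q ^ k) {b : Fin 6 → ℂ}
    (hb : ∏ j, b j = q) :
    jacksonForm q l m b = qPochInf q q * (theta q (l ^ 2) * theta q (m ^ 2) * theta q (l * m)) *
      theta q (m / l) * pairProd q b := by
  obtain ⟨κ, hκ⟩ := exists_jacksonForm_eq_mul_pairProd hq0 hq hl hm
  -- Avoiding countably many values of `x` and `y` keeps every factor of `pairProd` nonzero at the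
  -- special point, so that `κ` can be cancelled out. Pairs containing `w` are handled by their
  -- complement with respect to `m * x * y * w = q`.
  obtain ⟨x, hx, hxs⟩ := exists_forall_mul_ne_zpow q {m, l⁻¹, l}
  obtain ⟨y, hy, hys⟩ := exists_forall_mul_ne_zpow q {m, l⁻¹, l, x, m * x * l, m * x / l}
  have hw : m * x * y * (q / (m * x * y)) = q := by field_simp
  set w := q / (m * x * y)
  have hw0 : w ≠ 0 := by rintro e; rw [e, mul_zero] at hw; exact hq0 hw.symm
  have hinv : ∀ {z z' : ℂ}, z * z' = q → (∀ k : ℤ, z ≠ q ^ k) → ∀ k : ℤ, z' ≠ q ^ k :=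
    fun {z z'} e h k e' => h (1 - k) (by
      rw [zpow_sub₀ hq0, zpow_one, ← e', ← e]
      have : z' ≠ 0 := by rintro rfl; exact hq0 (by rw [← e, mul_zero])
      field_simp)
  have hx1 := hxs m (by simp) hm
  have hx2 := hxs l⁻¹ (by simp) (inv_ne_zero hl)
  have hx3 := hxs l (by simp) hl
  have hy1 := hys m (by simp) hm
  have hy2 := hys l⁻¹ (by simp) (inv_ne_zero hl)
  have hy3 := hys l (by simp) hl
  have hy4 := hys x (by simp) hx
  have hy5 := hys (m * x * l) (by simp) (by positivity)
  have hy6 := hys (m * x / l) (by simp) (by positivity)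
  have hl' := inv_ne_zero hl
  have hP : pairProd q ![m, x, y, w, l⁻¹, l] ≠ 0 := by
    rw [pairProd_eq]
    simp only [Matrix.cons_val]
    have g := fun {z : ℂ} (hz : z ≠ 0) (h : ∀ k : ℤ, z ≠ q ^ k) => qPochInf_div_ne_zero hq0 hq hz h
    have g45 : qPochInf q (q / (l⁻¹ * l)) ≠ 0 := by
      rw [inv_mul_cancel₀ hl, div_one]
      exact qPochInf_ne_zero_of_norm_lt hq hq
    refine mul_ne_zero (mul_ne_zero (mul_ne_zero (mul_ne_zero ?_ ?_) ?_) (mul_ne_zero ?_ ?_)) g45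
    · exact mul_ne_zero (g (by positivity) hx1) (mul_ne_zero (g (by positivity) hy1)
        (mul_ne_zero (g (by positivity) (hinv (by linear_combination hw) hy4))
        (mul_ne_zero (g (by positivity) h1) (g (by positivity) h2))))
    · exact mul_ne_zero (g (by positivity) hy4) (mul_ne_zero
        (g (by positivity) (hinv (by linear_combination hw) hy1)) (mul_ne_zero
        (g (by positivity) (by simpa only [mul_comm] using hx2))
        (g (by positivity) (by simpa only [mul_comm] using hx3))))
    · exact mul_ne_zero (g (by positivity) (hinv (by linear_combination hw) hx1)) (mul_ne_zero
        (g (by positivity) (by simpa only [mul_comm] using hy2))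
        (g (by positivity) (by simpa only [mul_comm] using hy3)))
    · exact g (by positivity) (hinv (by field_simp; linear_combination hw) hy5)
    · exact g (by positivity) (hinv (by field_simp; linear_combination hw) hy6)
  have hs := jacksonForm_special hq0 hq hl hx hy hw
  have hsp : ∏ j, ![m, x, y, w, l⁻¹, l] j = q := by
    rw [Fin.prod_univ_six]
    simp only [Matrix.cons_val]
    field_simp
    linear_combination hw
  rw [hκ _ hsp] at hs
  rw [hκ b hb, mul_right_cancel₀ hP hs]

/-- Both sides are continuous in `l ≠ 0`, and the values of `l` excluded by the generic case form a
countable set. -/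
theorem jacksonForm_eq (hq0 : q ≠ 0) (hq : ‖q‖ < 1) {l m : ℂ} (hl : l ≠ 0) (hm : m ≠ 0)
    {b : Fin 6 → ℂ} (hb : ∏ j, b j = q) :
    jacksonForm q l m b = qPochInf q q * (theta q (l ^ 2) * theta q (m ^ 2) * theta q (l * m)) *
      theta q (m / l) * pairProd q b := by
  have hd : DifferentiableOn ℂ (fun l => jacksonForm q l m b -
      qPochInf q q * (theta q (l ^ 2) * theta q (m ^ 2) * theta q (l * m)) *
      theta q (m / l) * pairProd q b) {0}ᶜ := by
    refine DifferentiableOn.sub ?_ ?_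
    · exact differentiableOn_jacksonForm hq0 hq isOpen_compl_singleton differentiableOn_id
        (differentiableOn_const m) (fun _ => differentiableOn_const _) (fun _ h => h)
        (fun _ _ => hm) fun _ _ => hb
    · refine DifferentiableOn.mul_const (DifferentiableOn.mul (DifferentiableOn.const_mul
        (DifferentiableOn.mul (DifferentiableOn.mul_const ?_ _) ?_) _) ?_) _
      · exact DifferentiableOn.theta hq (by fun_prop) fun t ht => pow_ne_zero 2 ht
      · exact DifferentiableOn.theta hq (by fun_prop) fun t ht => mul_ne_zero ht hm
      · exact DifferentiableOn.theta hq ((differentiableOn_const m).fun_div differentiableOn_id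
          fun _ h => h) fun t ht => div_ne_zero hm ht
  have hC : ({0} ∪ ⋃ k : ℤ, {m / q ^ k, q ^ k / m} : Set ℂ).Countable :=
    (Set.countable_singleton 0).union (Set.countable_iUnion fun k => Set.Countable.insert _
      (Set.countable_singleton _))
  refine sub_eq_zero.1 (eq_zero_of_eq_zero_off_countable (f := fun l => jacksonForm q l m b -
      qPochInf q q * (theta q (l ^ 2) * theta q (m ^ 2) * theta q (l * m)) *
      theta q (m / l) * pairProd q b) (hd.continuousOn.continuousAt (isOpen_compl_singleton.mem_nhds hl)) hC fun t ht => ?_)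
  simp only [Set.mem_union, Set.mem_singleton_iff, Set.mem_iUnion, Set.mem_insert_iff, not_or,
    not_exists] at ht
  refine sub_eq_zero.2 (jacksonForm_eq_of_generic hq0 hq ht.1 hm (fun k e => ?_) (fun k e => ?_) hb)
  · refine (ht.2 k).1 ?_
    have := ht.1
    rw [← e]
    field_simp
  · refine (ht.2 k).2 ?_
    rw [← e]
    field_simp

/-! ### The specialization `l = b₅`, `m = b₀`. -/

theorem thetaFactor_apply (hq : ‖q‖ < 1) {b : Fin 6 → ℂ} (h0 : ∀ j, b j ≠ 0) (i : Fin 6) :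
    thetaFactor q b (b i) = ∏ j, theta q (b i * b j) := by
  rw [thetaFactor, Finset.prod_eq_zero (i := i) (f := fun j => theta q (b i / b j))
    (Finset.mem_univ i) (by rw [div_self (h0 i), theta_one hq]), mul_zero, sub_zero]

/-- The defect in the specialization `l = b₅`, `m = b₀` of the bilateral Jackson summation, divided
by `θ(b₀ b₅)`. -/
noncomputable def jacksonDefect (q : ℂ) (b : Fin 6 → ℂ) : ℂ :=
  jacksonSum q b (b 5) * theta q (b 0 * b 0) * (∏ j ∈ Finset.Icc (1 : Fin 6) 4, theta q (b 0 * b j)) -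
    b 0 / b 5 * (jacksonSum q b (b 0) * theta q (b 5 * b 5) *
      ∏ j ∈ Finset.Icc (1 : Fin 6) 4, theta q (b 5 * b j)) -
    qPochInf q q * (theta q (b 5 * b 5) * theta q (b 0 * b 0)) * theta q (b 0 / b 5) * pairProd q b

theorem prod_univ_six_eq_prod_Icc (f : Fin 6 → ℂ) :
    ∏ j, f j = f 0 * f 5 * ∏ j ∈ Finset.Icc (1 : Fin 6) 4, f j := by
  have e : (Finset.Icc 1 4 : Finset (Fin 6)) = {1, 2, 3, 4} := by decide
  rw [Fin.prod_univ_six, e]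
  simp [Finset.prod_insert]
  ring

theorem theta_mul_jacksonDefect (hq0 : q ≠ 0) (hq : ‖q‖ < 1) {b : Fin 6 → ℂ} (hb : ∏ j, b j = q) :
    theta q (b 0 * b 5) * jacksonDefect q b = 0 := by
  have h0 := prod_ne_zero_apply hq0 hb
  have h := jacksonForm_eq hq0 hq (h0 5) (h0 0) hb
  rw [jacksonForm, thetaFactor_apply hq h0, thetaFactor_apply hq h0, prod_univ_six_eq_prod_Icc,
    prod_univ_six_eq_prod_Icc (fun j => theta q (b 5 * b j)), mul_comm (b 5) (b 0), pow_two,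
    pow_two] at h
  rw [jacksonDefect]
  linear_combination h

/-- To divide by `θ(b₀ b₅)` even where it vanishes, move `b₀` to `b₀ t` and `b₁` to `b₁ / t`. The
product of the parameters is unchanged, the theta factor vanishes for only countably many `t`, and
continuity at `t = 1` concludes. -/
theorem jacksonDefect_eq_zero (hq0 : q ≠ 0) (hq : ‖q‖ < 1) {b : Fin 6 → ℂ} (hb : ∏ j, b j = q) :
    jacksonDefect q b = 0 := by
  have h0 := prod_ne_zero_apply hq0 hb
  have hp : ∀ t ∈ ({0}ᶜ : Set ℂ), ∏ j, shiftPair b 0 1 t j = q := fun t ht =>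
    (prod_shiftPair b (by decide) ht).trans hb
  have hd : ∀ j, DifferentiableOn ℂ (fun t => shiftPair b 0 1 t j) {0}ᶜ :=
    differentiableOn_shiftPair b 0 1 fun _ h => h
  have hn : ∀ t ∈ ({0}ᶜ : Set ℂ), ∀ j, shiftPair b 0 1 t j ≠ 0 := fun t ht =>
    prod_ne_zero_apply hq0 (hp t ht)
  have hθ : ∀ i j, DifferentiableOn ℂ
      (fun t => theta q (shiftPair b 0 1 t i * shiftPair b 0 1 t j)) {0}ᶜ := fun i j =>
    DifferentiableOn.theta hq ((hd i).fun_mul (hd j)) fun t ht => mul_ne_zero (hn t ht i) (hn t ht j)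
  have hS : ∀ i, DifferentiableOn ℂ
      (fun t => jacksonSum q (shiftPair b 0 1 t) (shiftPair b 0 1 t i)) {0}ᶜ := fun i =>
    differentiableOn_jacksonSum hq0 hq isOpen_compl_singleton (hd i) hd (fun t ht => hn t ht i) hp
  have hD : DifferentiableOn ℂ (fun t => jacksonDefect q (shiftPair b 0 1 t)) {0}ᶜ := by
    have h05 := (hd 0).fun_div (hd 5) fun t ht => hn t ht 5
    refine DifferentiableOn.sub (DifferentiableOn.sub (((hS 5).mul (hθ 0 0)).mul ?_)
      (h05.mul (((hS 0).mul (hθ 5 5)).mul ?_))) ((((hθ 5 5).mul (hθ 0 0)).const_mul _).mul ?_ |>.mul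
        (differentiableOn_pairProd hq hd hn))
    · exact DifferentiableOn.fun_finsetProd fun j _ => hθ 0 j
    · exact DifferentiableOn.fun_finsetProd fun j _ => hθ 5 j
    · exact DifferentiableOn.theta hq h05 fun t ht => div_ne_zero (hn t ht 0) (hn t ht 5)
  have hC : ({0} ∪ ⋃ k : ℤ, {q ^ k / (b 0 * b 5)} : Set ℂ).Countable :=
    (Set.countable_singleton 0).union (Set.countable_iUnion fun k => Set.countable_singleton _)
  have e : shiftPair b 0 1 1 = b := by simp [shiftPair]
  have := eq_zero_of_eq_zero_off_countable (f := fun t => jacksonDefect q (shiftPair b 0 1 t))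
    (x := 1) (hD.continuousOn.continuousAt (isOpen_compl_singleton.mem_nhds one_ne_zero)) hC
    fun t ht => ?_
  · rwa [e] at this
  · simp only [Set.mem_union, Set.mem_singleton_iff, Set.mem_iUnion, not_or, not_exists] at ht
    refine (mul_eq_zero.1 (theta_mul_jacksonDefect hq0 hq (hp t ht.1))).resolve_left ?_
    refine theta_ne_zero hq0 hq (mul_ne_zero (hn t ht.1 0) (hn t ht.1 5)) fun k hk => ht.2 k ?_
    rw [shiftPair_left b (by decide), shiftPair_of_ne b (by decide) (by decide)] at hk
    rw [← hk]
    have := h0 0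
    have := h0 5
    field_simp

/-! ### From the regularized series back to `₈ψ₈`. -/

theorem qPoch_natCast (a : ℂ) (n : ℕ) : qPoch q a n = ∏ j ∈ Finset.range n, (1 - a * q ^ j) := rfl

/-- The last product does not depend on `a`, so it cancels in `psiTerm_neg` between equally many
numerator and denominator parameters. -/
theorem qPoch_neg_natCast (hq0 : q ≠ 0) {a : ℂ} (ha : a ≠ 0) (n : ℕ) :
    qPoch q a (-n) =
      (qPoch q (q / a) n * (a ^ n * ∏ j ∈ Finset.range n, -(q ^ (j + 1))⁻¹))⁻¹ := by
  have h : qPoch q a (-n) = (∏ j ∈ Finset.range n, (1 - a / q ^ (j + 1)))⁻¹ := by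
    cases n with
    | zero => simp [qPoch]
    | succ n => rfl
  rw [h, qPoch_natCast, ← Finset.card_range n, ← Finset.prod_const, Finset.card_range,
    ← Finset.prod_mul_distrib, ← Finset.prod_mul_distrib]
  congr 1
  refine Finset.prod_congr rfl fun j _ => ?_
  field_simp
  ring

theorem psiTerm_neg (hq0 : q ≠ 0) {r : ℕ} {a c : Fin r → ℂ} (ha : ∀ i, a i ≠ 0) (hc : ∀ i, c i ≠ 0)
    (z : ℂ) (n : ℕ) :
    psiTerm q a c z (-n) =
      psiTerm q (fun i => q / c i) (fun i => q / a i) ((∏ i, c i) / (∏ i, a i) / z) n := by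
  have hw : ∏ j ∈ Finset.range n, -(q ^ (j + 1))⁻¹ ≠ 0 :=
    Finset.prod_ne_zero_iff.2 fun j _ => neg_ne_zero.2 (inv_ne_zero (pow_ne_zero _ hq0))
  have hA : ∏ i, a i ≠ 0 := Finset.prod_ne_zero_iff.2 fun i _ => ha i
  have hCn : ∏ i, c i ≠ 0 := Finset.prod_ne_zero_iff.2 fun i _ => hc i
  rw [psiTerm, psiTerm, Finset.prod_congr rfl fun i _ => qPoch_neg_natCast hq0 (ha i) n,
    Finset.prod_congr rfl fun i _ => qPoch_neg_natCast hq0 (hc i) n]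
  simp only [Finset.prod_inv_distrib, Finset.prod_mul_distrib, Finset.prod_pow, Finset.prod_const,
    zpow_neg, zpow_natCast, div_pow, div_inv_eq_mul]
  set w := ∏ j ∈ Finset.range n, -(q ^ (j + 1))⁻¹
  field_simp

theorem numParams_inv (hq0 : q ≠ 0) {b : Fin 6 → ℂ} (h0 : ∀ j, b j ≠ 0) {l : ℂ} (hl : l ≠ 0) :
    (fun i => q / denParams q b l i) = numParams q b l⁻¹ := by
  ext i
  fin_cases i <;> simp [denParams, numParams] <;> field_simp [h0]

theorem denParams_inv (hq0 : q ≠ 0) {b : Fin 6 → ℂ} (h0 : ∀ j, b j ≠ 0) {l : ℂ} (hl : l ≠ 0) :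
    (fun i => q / numParams q b l i) = denParams q b l⁻¹ := by
  ext i
  fin_cases i <;> simp [denParams, numParams] <;> field_simp [h0]

theorem prod_numParams (b : Fin 6 → ℂ) (l : ℂ) (f : ℂ → ℂ) :
    ∏ i, f (numParams q b l i) = f (l * q) * f (-l * q) * ∏ j, f (l * b j) := by
  rw [Fin.prod_univ_eight, Fin.prod_univ_six]
  simp only [numParams, Matrix.cons_val]
  ring

theorem prod_denParams (b : Fin 6 → ℂ) (l : ℂ) (f : ℂ → ℂ) :
    ∏ i, f (denParams q b l i) = f l * f (-l) * ∏ j, f (l * q / b j) := by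
  rw [Fin.prod_univ_eight, Fin.prod_univ_six]
  simp only [denParams, Matrix.cons_val]
  ring

/-- Reversal of the series exchanges `l` and `l⁻¹`; it preserves the argument `q` because of `∏ b_j
= q`. -/
theorem psiTerm_params_neg (hq0 : q ≠ 0) {b : Fin 6 → ℂ} (hb : ∏ j, b j = q) {l : ℂ} (hl : l ≠ 0)
    (n : ℕ) :
    psiTerm q (numParams q b l) (denParams q b l) q (-n) =
      psiTerm q (numParams q b l⁻¹) (denParams q b l⁻¹) q n := by
  have h0 := prod_ne_zero_apply hq0 hb
  have hz : (∏ i, denParams q b l i) / (∏ i, numParams q b l i) / q = q := by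
    have h1 := prod_numParams (q := q) b l id
    have h2 := prod_denParams (q := q) b l id
    simp only [id] at h1 h2
    rw [h1, h2, Finset.prod_div_distrib, Finset.prod_mul_distrib, Finset.prod_mul_distrib, hb]
    simp only [Finset.prod_const, Finset.card_univ, Fintype.card_fin]
    field_simp
  have hnum : ∀ i, numParams q b l i ≠ 0 := by
    intro i
    fin_cases i <;> simp [numParams, hl, hq0, h0]
  have hden : ∀ i, denParams q b l i ≠ 0 := by
    intro i
    fin_cases i <;> simp [denParams, hl, hq0, h0]
  rw [psiTerm_neg hq0 hnum hden, hz, numParams_inv hq0 h0 hl, denParams_inv hq0 h0 hl]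

theorem qPoch_mul_one_sub (a : ℂ) (n : ℕ) :
    qPoch q (a * q) n * (1 - a) = qPoch q a n * (1 - a * q ^ n) := by
  rw [qPoch_natCast, qPoch_natCast, ← Finset.prod_range_succ, Finset.prod_range_succ', pow_zero,
    mul_one]
  congr 1
  exact Finset.prod_congr rfl fun j _ => by ring

theorem Generic.inv (hq0 : q ≠ 0) {b : Fin 6 → ℂ} {l : ℂ} (h : Generic q b l) :
    Generic q b l⁻¹ where
  ne_zero := inv_ne_zero h.ne_zero
  sq_ne k := by
    have := h.sq_ne (-k)
    rw [zpow_neg] at this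
    refine ⟨fun e => this.1 ?_, fun e => this.2 ?_⟩
    · rw [← e, inv_inv]
    · rw [← inv_neg, ← e, inv_inv]
  den_ne j m hm e := h.num_ne j m hm (by
    have := h.ne_zero
    rw [← e]
    field_simp)
  num_ne j m hm e := h.den_ne j m hm (by
    have := h.ne_zero
    rw [← e]
    field_simp)

theorem Generic.one_sub_mul_ne_zero {b : Fin 6 → ℂ} {l : ℂ} (h : Generic q b l)
    (n : ℕ) : 1 - l * q ^ n ≠ 0 := fun e => (h.sq_ne (-n)).1 (by
  rw [zpow_neg, zpow_natCast]
  exact eq_inv_of_mul_eq_one_left (sub_eq_zero.1 e).symm)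

theorem Generic.one_add_mul_ne_zero {b : Fin 6 → ℂ} {l : ℂ} (h : Generic q b l)
    (n : ℕ) : 1 - -l * q ^ n ≠ 0 := fun e => (h.sq_ne (-n)).2 (by
  rw [zpow_neg, zpow_natCast]
  have := eq_inv_of_mul_eq_one_left (sub_eq_zero.1 e).symm
  rw [← this, neg_neg])

theorem Generic.one_sub_sq_ne_zero {b : Fin 6 → ℂ} {l : ℂ} (h : Generic q b l) :
    1 - l ^ 2 ≠ 0 := by
  have h1 := h.one_sub_mul_ne_zero 0
  have h2 := h.one_add_mul_ne_zero 0
  rw [pow_zero, mul_one] at h1 h2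
  rw [show 1 - l ^ 2 = (1 - l) * (1 - -l) by ring]
  exact mul_ne_zero h1 h2

theorem Generic.qPochInf_mul_div_ne_zero {b : Fin 6 → ℂ} {l : ℂ} (h : Generic q b l) (hq : ‖q‖ < 1)
    (h0 : ∀ j, b j ≠ 0) (j : Fin 6) : qPochInf q (q * l / b j) ≠ 0 := by
  refine qPochInf_ne_zero hq fun n e => h.den_ne j (n + 1) (by simp) ?_
  have := h0 j
  field_simp at e
  rw [← e]
  ring

theorem Generic.qPochInf_div_mul_ne_zero {b : Fin 6 → ℂ} {l : ℂ} (h : Generic q b l) (hq : ‖q‖ < 1)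
    (h0 : ∀ j, b j ≠ 0) (j : Fin 6) : qPochInf q (q / (l * b j)) ≠ 0 := by
  refine qPochInf_ne_zero hq fun n e => h.num_ne j (n + 1) (by simp) ?_
  have := h0 j
  have := h.ne_zero
  field_simp at e
  rw [← e]
  ring

theorem psiTerm_natCast {b : Fin 6 → ℂ} {l : ℂ} (h : Generic q b l) (n : ℕ) :
    psiTerm q (numParams q b l) (denParams q b l) q n =
      (1 - l ^ 2 * q ^ (2 * n)) / (1 - l ^ 2) *
        ((∏ j, qPoch q (l * b j) n) / ∏ j, qPoch q (l * q / b j) n) * q ^ n := by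
  have e1 := qPoch_mul_one_sub (q := q) l n
  have e2 := qPoch_mul_one_sub (q := q) (-l) n
  have n1 : qPoch q l n ≠ 0 :=
    Finset.prod_ne_zero_iff.2 fun j _ => h.one_sub_mul_ne_zero j
  have n2 : qPoch q (-l) n ≠ 0 :=
    Finset.prod_ne_zero_iff.2 fun j _ => h.one_add_mul_ne_zero j
  have n3 := h.one_sub_sq_ne_zero
  have e : qPoch q (l * q) n * qPoch q (-l * q) n / (qPoch q l n * qPoch q (-l) n) =
      (1 - l ^ 2 * q ^ (2 * n)) / (1 - l ^ 2) := by
    rw [div_eq_div_iff (mul_ne_zero n1 n2) n3, show 1 - l ^ 2 = (1 - l) * (1 - -l) by ring]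
    calc _ = (qPoch q (l * q) n * (1 - l)) * (qPoch q (-l * q) n * (1 - -l)) := by ring
      _ = _ := by rw [e1, e2]; ring
  rw [psiTerm, prod_numParams b l (fun x => qPoch q x n), prod_denParams b l (fun x => qPoch q x n),
    ← e, zpow_natCast]
  simp only [div_eq_mul_inv, mul_inv]
  ring

theorem jacksonTerm_natCast_eq_psiTerm (hq0 : q ≠ 0) (hq : ‖q‖ < 1) {b : Fin 6 → ℂ}
    (hb : ∏ j, b j = q) {l : ℂ} (h : Generic q b l) (n : ℕ) :
    jacksonTerm q b l n = (1 - l ^ 2) *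
      (∏ j, qPochInf q (q * l / b j) * qPochInf q (q / (l * b j))) *
        psiTerm q (numParams q b l) (denParams q b l) q n := by
  have h0 := prod_ne_zero_apply hq0 hb
  have n3 := h.one_sub_sq_ne_zero
  have e : ∀ j, qPochInf q (q * l / b j) =
      qPoch q (l * q / b j) n * qPochInf q (q * (l * q ^ n) / b j) := fun j => by
    rw [qPochInf_eq_prod_mul hq _ n, qPoch_natCast, mul_comm q l,
      show l * q / b j * q ^ n = q * (l * q ^ n) / b j by ring]
  have hne : ∏ j, qPoch q (l * q / b j) n ≠ 0 := Finset.prod_ne_zero_iff.2 fun j _ => by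
    have := h.qPochInf_mul_div_ne_zero hq h0 j
    rw [e] at this
    exact left_ne_zero_of_mul this
  rw [jacksonTerm_natCast hq0 hq hb h.ne_zero, psiTerm_natCast h]
  simp_rw [e, ← qPoch_natCast, Finset.prod_mul_distrib]
  field_simp
  ring

theorem jacksonTerm_eq_psiTerm (hq0 : q ≠ 0) (hq : ‖q‖ < 1) {b : Fin 6 → ℂ}
    (hb : ∏ j, b j = q) {l : ℂ} (h : Generic q b l) (k : ℤ) :
    jacksonTerm q b l k = (1 - l ^ 2) *
      (∏ j, qPochInf q (q * l / b j) * qPochInf q (q / (l * b j))) *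
        psiTerm q (numParams q b l) (denParams q b l) q k := by
  obtain ⟨n, rfl | rfl⟩ := k.eq_nat_or_neg
  · exact jacksonTerm_natCast_eq_psiTerm hq0 hq hb h n
  · have hl := h.ne_zero
    rw [jacksonTerm_neg hq0 b hl, jacksonTerm_natCast_eq_psiTerm hq0 hq hb (h.inv hq0),
      psiTerm_params_neg hq0 hb hl]
    have e : ∀ j, qPochInf q (q * l⁻¹ / b j) * qPochInf q (q / (l⁻¹ * b j)) =
        qPochInf q (q * l / b j) * qPochInf q (q / (l * b j)) := fun j => by
      rw [mul_comm, show q / (l⁻¹ * b j) = q * l / b j by field_simp,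
        show q * l⁻¹ / b j = q / (l * b j) by field_simp]
    simp_rw [e]
    field_simp
    ring

theorem Generic.prod_ne_zero {b : Fin 6 → ℂ} {l : ℂ} (h : Generic q b l) (hq : ‖q‖ < 1)
    (h0 : ∀ j, b j ≠ 0) :
    (1 - l ^ 2) * (∏ j, qPochInf q (q * l / b j) * qPochInf q (q / (l * b j))) ≠ 0 :=
  mul_ne_zero (h.one_sub_sq_ne_zero) (Finset.prod_ne_zero_iff.2 fun j _ =>
    mul_ne_zero (h.qPochInf_mul_div_ne_zero hq h0 j) (h.qPochInf_div_mul_ne_zero hq h0 j))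

theorem summable_psiTerm (hq0 : q ≠ 0) (hq : ‖q‖ < 1) {b : Fin 6 → ℂ}
    (hb : ∏ j, b j = q) {l : ℂ} (h : Generic q b l) :
    Summable (psiTerm q (numParams q b l) (denParams q b l) q) := by
  have hs := summable_jacksonTerm hq0 hq hb h.ne_zero
  rw [funext (jacksonTerm_eq_psiTerm hq0 hq hb h)] at hs
  exact (summable_mul_left_iff (h.prod_ne_zero hq (prod_ne_zero_apply hq0 hb))).1 hs

theorem jacksonSum_eq_psi (hq0 : q ≠ 0) (hq : ‖q‖ < 1) {b : Fin 6 → ℂ}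
    (hb : ∏ j, b j = q) {l : ℂ} (h : Generic q b l) :
    jacksonSum q b l = (1 - l ^ 2) *
      (∏ j, qPochInf q (q * l / b j) * qPochInf q (q / (l * b j))) *
        psi q (numParams q b l) (denParams q b l) q := by
  rw [jacksonSum, tsum_congr (jacksonTerm_eq_psiTerm hq0 hq hb h), tsum_mul_left, psi]

/-- The relation `θ(l/m) = -(l/m) θ(m/l)` turns the symmetric sum into the antisymmetric
`jacksonForm` divided by `θ(m/l)`. -/
theorem jacksonSummand_add (hq0 : q ≠ 0) (hq : ‖q‖ < 1) {b : Fin 6 → ℂ} (hb : ∏ j, b j = q)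
    {l m : ℂ} (hl : Generic q b l) (hm : Generic q b m) (h : ∀ k : ℤ, m ≠ l * q ^ k) :
    jacksonSummand q b l m + jacksonSummand q b m l =
      qPochInf q q * (theta q (l ^ 2) * theta q (m ^ 2) * theta q (l * m)) * pairProd q b := by
  have hl0 := hl.ne_zero
  have hm0 := hm.ne_zero
  have hθ : theta q (m / l) ≠ 0 := theta_ne_zero hq0 hq (div_ne_zero hm0 hl0) fun k e => h k (by
    rw [← e]
    field_simp)
  have hθ' : theta q (l / m) = -theta q (m / l) / (m / l) := by
    rw [← theta_inv hq (div_ne_zero hm0 hl0), inv_div]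
  have e := jacksonForm_eq hq0 hq hl0 hm0 hb
  rw [jacksonForm, jacksonSum_eq_psi hq0 hq hb hl, jacksonSum_eq_psi hq0 hq hb hm, thetaFactor,
    thetaFactor] at e
  rw [jacksonSummand, jacksonSummand, hθ']
  refine mul_right_cancel₀ hθ (Eq.trans ?_ (e.trans (by ring)))
  field_simp
  ring

/-! ### Reduction to unilateral series and the nonterminating summation. -/

theorem psiTerm_negSucc_apply (hq0 : q ≠ 0) {b : Fin 6 → ℂ} (h0 : ∀ j, b j ≠ 0) (i : Fin 6) (n : ℕ) :
    psiTerm q (numParams q b (b i)) (denParams q b (b i)) q (Int.negSucc n) = 0 := by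
  -- Mathematically `1 / (q)_k = 0` for `k < 0`. Here `(q)_k` itself is `0⁻¹ = 0`, and division by
  -- zero gives the term the same value `0`.
  have h : qPoch q (b i * q / b i) (Int.negSucc n) = 0 := by
    rw [mul_div_cancel_left₀ _ (h0 i), qPoch, Finset.prod_eq_zero (i := 0) (by simp), inv_zero]
    field_simp
    simp
  rw [psiTerm, prod_denParams b (b i) (fun x => qPoch q x (Int.negSucc n)),
    Finset.prod_eq_zero (f := fun j => qPoch q (b i * q / b j) (Int.negSucc n))
    (Finset.mem_univ i) h]
  simp

theorem support_psiTerm_subset (hq0 : q ≠ 0) {b : Fin 6 → ℂ} (h0 : ∀ j, b j ≠ 0) (i : Fin 6) :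
    Function.support (psiTerm q (numParams q b (b i)) (denParams q b (b i)) q) ⊆
      Set.range ((↑) : ℕ → ℤ) := by
  intro k hk
  cases k with
  | ofNat n => exact ⟨n, rfl⟩
  | negSucc n => exact absurd (psiTerm_negSucc_apply hq0 h0 i n) hk

theorem psiTerm_five_eq_wTerm {b : Fin 6 → ℂ} (h0 : ∀ j, b j ≠ 0)
    (h : Generic q b (b 5)) (n : ℕ) :
    psiTerm q (numParams q b (b 5)) (denParams q b (b 5)) q n =
      wTerm q (b 5 ^ 2) ![b 0 * b 5, b 1 * b 5, b 2 * b 5, b 3 * b 5, b 4 * b 5] q n := by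
  have h5 := h0 5
  have e : ∀ j, b 5 ^ 2 * q / (b j * b 5) = b 5 * q / b j := fun j => by
    have := h0 j
    field_simp
  rw [psiTerm_natCast h, wTerm, Fin.prod_univ_six, Fin.prod_univ_six, Fin.prod_univ_five,
    Fin.prod_univ_five]
  simp only [Matrix.cons_val, e, mul_div_cancel_left₀ _ h5]
  rw [pow_two (b 5), mul_comm (b 0), mul_comm (b 1), mul_comm (b 2), mul_comm (b 3),
    mul_comm (b 4)]
  congr 3 <;> ring

theorem psiTerm_zero_eq_wTerm {b : Fin 6 → ℂ} (h0 : ∀ j, b j ≠ 0)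
    (h : Generic q b (b 0)) (n : ℕ) :
    psiTerm q (numParams q b (b 0)) (denParams q b (b 0)) q n =
      wTerm q (b 0 ^ 2) ![b 0 * b 1, b 0 * b 2, b 0 * b 3, b 0 * b 4, b 0 * b 5] q n := by
  have h5 := h0 0
  have e : ∀ j, b 0 ^ 2 * q / (b 0 * b j) = b 0 * q / b j := fun j => by
    have := h0 j
    field_simp
  rw [psiTerm_natCast h, wTerm, Fin.prod_univ_six, Fin.prod_univ_six, Fin.prod_univ_five,
    Fin.prod_univ_five]
  simp only [Matrix.cons_val, e, mul_div_cancel_left₀ _ h5]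
  rw [pow_two (b 0)]
  congr 3 <;> ring

theorem summable_and_psi_eq_W (hq0 : q ≠ 0) (hq : ‖q‖ < 1) {b : Fin 6 → ℂ} (hb : ∏ j, b j = q)
    {i : Fin 6} (h : Generic q b (b i)) {a : ℂ} {c : Fin 5 → ℂ}
    (hw : ∀ n : ℕ, psiTerm q (numParams q b (b i)) (denParams q b (b i)) q n = wTerm q a c q n) :
    Summable (wTerm q a c q) ∧ psi q (numParams q b (b i)) (denParams q b (b i)) q = W q a c q := by
  have h0 := prod_ne_zero_apply hq0 hb
  refine ⟨((summable_psiTerm hq0 hq hb h).comp_injective Nat.cast_injective).congr hw, ?_⟩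
  rw [psi, W, ← Nat.cast_injective.tsum_eq (support_psiTerm_subset hq0 h0 i)]
  exact tsum_congr hw

theorem nonterminating_jackson (hq0 : q ≠ 0) (hq : ‖q‖ < 1) {b : Fin 6 → ℂ} (hb : ∏ j, b j = q)
    (hg5 : Generic q b (b 5)) (hg0 : Generic q b (b 0)) (hsq : ∀ n : ℕ, 1 ≤ n → b 0 ^ 2 * q ^ n ≠ 1)
    (hj : ∀ j ∈ Finset.Icc (1 : Fin 6) 4, ∀ n : ℕ, b 0 * b j * q ^ n ≠ 1) :
    psi q (numParams q b (b 5)) (denParams q b (b 5)) q -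
        b 0 / b 5 * (qPochInf q (q * b 5 ^ 2) * qPochInf q (q * b 0 / b 5) /
            (qPochInf q (q * b 0 ^ 2) * qPochInf q (q * b 5 / b 0))) *
          (∏ j ∈ Finset.Icc (1 : Fin 6) 4, qPochInf q (q * b 0 / b j) * qPochInf q (b 5 * b j) /
              (qPochInf q (q * b 5 / b j) * qPochInf q (b 0 * b j))) *
          psi q (numParams q b (b 0)) (denParams q b (b 0)) q =
      qPochInf q (q * b 5 ^ 2) * qPochInf q (b 0 / b 5) *
          (∏ i ∈ Finset.Icc (1 : Fin 6) 4, ∏ j ∈ Finset.Ioc i 4, qPochInf q (q / (b i * b j))) /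
        ∏ j ∈ Finset.Icc (1 : Fin 6) 4, qPochInf q (q * b 5 / b j) * qPochInf q (b 0 * b j) := by
  have h0 := prod_ne_zero_apply hq0 hb
  have key := jacksonDefect_eq_zero hq0 hq hb
  have hpair : pairProd q b = qPochInf q (q / (b 0 * b 5)) *
      (∏ j ∈ Finset.Icc (1 : Fin 6) 4, qPochInf q (q / (b 0 * b j))) *
      (∏ j ∈ Finset.Icc (1 : Fin 6) 4, qPochInf q (q / (b 5 * b j))) *
      ∏ i ∈ Finset.Icc (1 : Fin 6) 4, ∏ j ∈ Finset.Ioc i 4, qPochInf q (q / (b i * b j)) := by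
    have e : (Finset.Icc 1 4 : Finset (Fin 6)) = {1, 2, 3, 4} := by decide
    have e1 : (Finset.Ioc 1 4 : Finset (Fin 6)) = {2, 3, 4} := by decide
    have e2 : (Finset.Ioc 2 4 : Finset (Fin 6)) = {3, 4} := by decide
    have e3 : (Finset.Ioc 3 4 : Finset (Fin 6)) = {4} := by decide
    rw [pairProd_eq, e]
    simp [Finset.prod_insert, e1, e2, e3, mul_comm (b 5)]
    ring
  have n1 : ∏ j ∈ Finset.Icc (1 : Fin 6) 4, qPochInf q (q / (b 0 * b j)) ≠ 0 :=
    Finset.prod_ne_zero_iff.2 fun j _ => hg0.qPochInf_div_mul_ne_zero hq h0 j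
  have n2 : ∏ j ∈ Finset.Icc (1 : Fin 6) 4, qPochInf q (q / (b 5 * b j)) ≠ 0 :=
    Finset.prod_ne_zero_iff.2 fun j _ => hg5.qPochInf_div_mul_ne_zero hq h0 j
  have n3 : ∏ j ∈ Finset.Icc (1 : Fin 6) 4, qPochInf q (q * b 5 / b j) ≠ 0 :=
    Finset.prod_ne_zero_iff.2 fun j _ => hg5.qPochInf_mul_div_ne_zero hq h0 j
  have n4 : ∏ j ∈ Finset.Icc (1 : Fin 6) 4, qPochInf q (b 0 * b j) ≠ 0 :=
    Finset.prod_ne_zero_iff.2 fun j hjm => qPochInf_ne_zero hq (hj j hjm)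
  have n5 := hg5.one_sub_sq_ne_zero
  have n6 := hg0.one_sub_sq_ne_zero
  have n7 := hg5.qPochInf_div_mul_ne_zero hq h0 5
  have n8 := hg0.qPochInf_div_mul_ne_zero hq h0 0
  have n9 := hg0.qPochInf_div_mul_ne_zero hq h0 5
  have n10 := qPochInf_ne_zero_of_norm_lt hq hq
  have n11 := hg5.qPochInf_mul_div_ne_zero hq h0 0
  have n12 : qPochInf q (q * b 0 ^ 2) ≠ 0 := qPochInf_ne_zero hq fun n e =>
    hsq (n + 1) (by simp) (by rw [← e]; ring)
  rw [← pow_two] at n7 n8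
  rw [jacksonDefect, jacksonSum_eq_psi hq0 hq hb hg5, jacksonSum_eq_psi hq0 hq hb hg0, hpair,
    prod_univ_six_eq_prod_Icc, prod_univ_six_eq_prod_Icc (fun j => qPochInf q (q * b 0 / b j) *
      qPochInf q (q / (b 0 * b j))), mul_div_cancel_right₀ _ (h0 5), mul_div_cancel_right₀ _ (h0 0),
    ← pow_two, ← pow_two, theta_eq_one_sub_mul hq (b 0 ^ 2), theta_eq_one_sub_mul hq (b 5 ^ 2),
    mul_comm (b 5) (b 0), theta, show q / (b 0 / b 5) = q * b 5 / b 0 by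
      have := h0 5
      have := h0 0
      field_simp] at key
  simp only [theta, Finset.prod_mul_distrib, Finset.prod_div_distrib] at key ⊢
  set A₀ := ∏ j ∈ Finset.Icc (1 : Fin 6) 4, qPochInf q (q * b 0 / b j)
  set A₅ := ∏ j ∈ Finset.Icc (1 : Fin 6) 4, qPochInf q (q * b 5 / b j)
  set B₀ := ∏ j ∈ Finset.Icc (1 : Fin 6) 4, qPochInf q (q / (b 0 * b j))
  set B₅ := ∏ j ∈ Finset.Icc (1 : Fin 6) 4, qPochInf q (q / (b 5 * b j))
  set C₀ := ∏ j ∈ Finset.Icc (1 : Fin 6) 4, qPochInf q (b 0 * b j)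
  set C₅ := ∏ j ∈ Finset.Icc (1 : Fin 6) 4, qPochInf q (b 5 * b j)
  have h5 := h0 5
  -- Up to the denominators cleared afterwards, this is the nonzero factor by which `jacksonDefect`
  -- exceeds the stated identity.
  have hG : (1 - b 5 ^ 2) * (1 - b 0 ^ 2) * qPochInf q (q / b 5 ^ 2) * qPochInf q (q / b 0 ^ 2) *
      qPochInf q q * qPochInf q (q / (b 0 * b 5)) * B₅ * B₀ ≠ 0 := by
    simp only [mul_ne_zero_iff]
    exact ⟨⟨⟨⟨⟨⟨⟨n5, n6⟩, n7⟩, n8⟩, n10⟩, n9⟩, n2⟩, n1⟩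
  rw [eq_div_iff (mul_ne_zero n3 n4)]
  refine mul_left_cancel₀ (mul_ne_zero hG (mul_ne_zero n11 n12)) ?_
  rw [← sub_eq_zero, ← key]
  generalize qPochInf q (q * b 5 / b 0) = x at *
  generalize qPochInf q (q * b 0 ^ 2) = y at *
  generalize qPochInf q (q / (b 0 * b 5)) = z at *
  field_simp

end BilateralJackson

theorem mainTheorem4 (q : ℂ) (hq0 : q ≠ 0) (hq1 : ‖q‖ < 1)
    (b : Fin 6 → ℂ) (hb : ∏ j, b j = q) :
    -- the bilateral Jackson summation
    (∀ l m : ℂ, BilateralJackson.Generic q b l → BilateralJackson.Generic q b m →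
      (∀ k : ℤ, m ≠ l * q ^ k) →
      Summable (BilateralJackson.psiTerm q (BilateralJackson.numParams q b l)
        (BilateralJackson.denParams q b l) q) ∧
      Summable (BilateralJackson.psiTerm q (BilateralJackson.numParams q b m)
        (BilateralJackson.denParams q b m) q) ∧
      BilateralJackson.jacksonSummand q b l m + BilateralJackson.jacksonSummand q b m l =
        BilateralJackson.qPochInf q q *
          (BilateralJackson.theta q (l ^ 2) * BilateralJackson.theta q (m ^ 2) *
            BilateralJackson.theta q (l * m)) *
          ∏ i, ∏ j ∈ Finset.Ioi i, BilateralJackson.qPochInf q (q / (b i * b j))) ∧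
    -- the case `l = b₆`, `m = b₁`: the nonterminating Jackson summation
    (BilateralJackson.Generic q b (b 5) → BilateralJackson.Generic q b (b 0) →
      (∀ k : ℤ, b 0 ≠ b 5 * q ^ k) →
      (∀ n : ℕ, 1 ≤ n → b 0 ^ 2 * q ^ n ≠ 1) →
      (∀ j ∈ Finset.Icc (1 : Fin 6) 4, ∀ n : ℕ, b 0 * b j * q ^ n ≠ 1) →
      Summable (BilateralJackson.wTerm q (b 5 ^ 2)
        ![b 0 * b 5, b 1 * b 5, b 2 * b 5, b 3 * b 5, b 4 * b 5] q) ∧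
      Summable (BilateralJackson.wTerm q (b 0 ^ 2)
        ![b 0 * b 1, b 0 * b 2, b 0 * b 3, b 0 * b 4, b 0 * b 5] q) ∧
      BilateralJackson.psi q (BilateralJackson.numParams q b (b 5))
          (BilateralJackson.denParams q b (b 5)) q =
        BilateralJackson.W q (b 5 ^ 2)
          ![b 0 * b 5, b 1 * b 5, b 2 * b 5, b 3 * b 5, b 4 * b 5] q ∧
      BilateralJackson.psi q (BilateralJackson.numParams q b (b 0))
          (BilateralJackson.denParams q b (b 0)) q =
        BilateralJackson.W q (b 0 ^ 2)
          ![b 0 * b 1, b 0 * b 2, b 0 * b 3, b 0 * b 4, b 0 * b 5] q ∧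
      BilateralJackson.W q (b 5 ^ 2)
          ![b 0 * b 5, b 1 * b 5, b 2 * b 5, b 3 * b 5, b 4 * b 5] q -
        b 0 / b 5 *
          (BilateralJackson.qPochInf q (q * b 5 ^ 2) *
              BilateralJackson.qPochInf q (q * b 0 / b 5) /
            (BilateralJackson.qPochInf q (q * b 0 ^ 2) *
              BilateralJackson.qPochInf q (q * b 5 / b 0))) *
          (∏ j ∈ Finset.Icc (1 : Fin 6) 4,
            BilateralJackson.qPochInf q (q * b 0 / b j) *
                BilateralJackson.qPochInf q (b 5 * b j) /
              (BilateralJackson.qPochInf q (q * b 5 / b j) *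
                BilateralJackson.qPochInf q (b 0 * b j))) *
          BilateralJackson.W q (b 0 ^ 2)
            ![b 0 * b 1, b 0 * b 2, b 0 * b 3, b 0 * b 4, b 0 * b 5] q =
        BilateralJackson.qPochInf q (q * b 5 ^ 2) *
            BilateralJackson.qPochInf q (b 0 / b 5) *
            (∏ i ∈ Finset.Icc (1 : Fin 6) 4, ∏ j ∈ Finset.Ioc i 4,
              BilateralJackson.qPochInf q (q / (b i * b j))) /
          ∏ j ∈ Finset.Icc (1 : Fin 6) 4,
            BilateralJackson.qPochInf q (q * b 5 / b j) *
              BilateralJackson.qPochInf q (b 0 * b j)) := by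
  have h0 := BilateralJackson.prod_ne_zero_apply hq0 hb
  refine ⟨fun l m hl hm h => ⟨BilateralJackson.summable_psiTerm hq0 hq1 hb hl,
    BilateralJackson.summable_psiTerm hq0 hq1 hb hm,
    BilateralJackson.jacksonSummand_add hq0 hq1 hb hl hm h⟩, fun hg5 hg0 _ hsq hj => ?_⟩
  obtain ⟨s5, e5⟩ := BilateralJackson.summable_and_psi_eq_W hq0 hq1 hb hg5
    (BilateralJackson.psiTerm_five_eq_wTerm h0 hg5)
  obtain ⟨s0, e0⟩ := BilateralJackson.summable_and_psi_eq_W hq0 hq1 hb hg0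
    (BilateralJackson.psiTerm_zero_eq_wTerm h0 hg0)
  refine ⟨s5, s0, e5, e0, ?_⟩
  rw [← e5, ← e0]
  exact BilateralJackson.nonterminating_jackson hq0 hq1 hb hg5 hg0 hsq hj
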